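/- Let $\Gamma$ be a divisible totally ordered abelian group, and let $\mathbb{T}_{\max}=(\Gamma\cup\{\bot\},\max,+)$ be the tropical semifield over $\Gamma$, with zero $\mathbb{0}=\bot$ and unit $\mathbb{1}=0_\Gamma$. Let $\mathbb{S}_{\max}$ be the symmetrized tropical semiring over $\Gamma$, that is, the quotient of the semiring $\mathbb{T}_{\max}^2$ with $$(a_1,a_2)\oplus(b_1,b_2)=(a_1\oplus b_1,a_2\oplus b_2),\qquad (a_1,a_2)\odot(b_1,b_2)=(a_1b_1\oplus a_2b_2,\;a_1b_2\oplus a_2b_1)$$ by the congruence that identifies $(a_1,a_2)$ and $(b_1,b_2)$ if they are equal or if $a_1\ne a_2$, $b_1\neq b_2$ and $a_1\oplus b_2=a_2\oplus b_1$. Write $\ominus(a_1,a_2)=(a_2,a_1)$ and $|(a_1,a_2)|=a_1\oplus a_2\in\mathbb{T}_{\max}$, and identify $c\in\mathbb{T}_{\max}$ with the class of $(c,\bot)$. Let $\mathbb{S}_{\max}^{\oplus}$, $\mathbb{S}_{\max}^{\ominus}$, $\mathbb{S}_{\max}^{\circ}$ be the sets of the classes of the pairs $(c,\bot)$, $(\bot,c)$,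 $(c,c)$ respectively, and let $\mathbb{S}_{\max}^\vee=\mathbb{S}_{\max}^\oplus\cup\mathbb{S}_{\max}^\ominus$ be the set of signed elements. Write $a\preceq^\circ b$ if $b=a\oplus c$ for some $c\in \mathbb{S}_{\max}^\circ$, and $a\,\nabla\, b$ if $\mathbb{0}\preceq^\circ a\ominus b$; for formal polynomials, $\nabla$ is understood coefficient by coefficient. For $P=\bigoplus_k P_k\mathsf{Y}^k$ with coefficients in $\mathbb{S}_{\max}^\vee$ and $r\in\mathbb{S}_{\max}^\vee$, denote by $\widehat P$ the associated polynomial function; $r$ is a root of $P$ if $\mathbb{0}\preceq^\circ\widehat P(r)$. The multiplicity $\mathrm{mult}_r(P)$ is $0$ if $r$ is not a root of $P$, and otherwise $$\mathrm{mult}_r(P)=1+\max\{\mathrm{mult}_r(Q)\mid Q\in\mathbb{S}_{\max}^\vee[\mathsf{Y}],\ \lambda\in\mathbb{S}_{\max}^\vee\setminus\{\mathbb{0}\},\ \lambda P\,\nabla\,(\mathsf{Y}\ominus r)Q\}.$$ Let $|P|=\bigoplus_k|P_k|\mathsf{Y}^k\in\mathbb{T}_{\max}[\mathsf{Y}]$.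 A nonzero corner of $|P|$ is an element $c\in\Gamma$ at which the maximum $\max_k(|P_k|+kc)$ is attained by at least two different monomials of $|P|$. For such a $c$, the saturation polynomial is $$P^{\mathrm{sat},c}=\bigoplus_{i\in \mathrm{sat}(c,P)}|\widehat P(c)|^{\odot -1}\odot c^{\odot i}\odot P_i\,\mathsf{Y}^i,\qquad \mathrm{sat}(c,P)=\{i\in\{0,\ldots,\deg P\}\mid |\widehat P(c)|=|P_i|\odot |c|^{\odot i}\}.$$ Let $\mathbf R$ be an ordered field and let $\mathrm{sv}:\mathbf R\to\mathbb{S}_{\max}$ be a morphism of semiring systems, that is: $\mathrm{sv}(0)=\mathbb{0}$; $\mathrm{sv}(x)\in\mathbb{S}_{\max}^\vee\setminus\{\mathbb{0}\}$ if $x\ne0$; and $\mathrm{sv}(-x)=\ominus\,\mathrm{sv}(x)$, $\mathrm{sv}(x+y)\preceq^\circ\mathrm{sv}(x)\oplus\mathrm{sv}(y)$ and $\mathrm{sv}(xy)=\mathrm{sv}(x)\odot\mathrm{sv}(y)$ for all $x,y\in\mathbf{R}$. Let $\mathbf P=\sum_{k=0}^n\mathbf P_k\mathsf{Y}^k\in\mathbf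 R[\mathsf{Y}]$ have degree $n$ and exactly $n$ roots $x_1,\ldots,x_n$ in $\mathbf R$, counted with multiplicities; equivalently, $\mathbf P=\mathbf P_n(\mathsf{Y}-x_1)\cdots(\mathsf{Y}-x_n)$ with $\mathbf P_n\neq0$. Let $P=\mathrm{sv}(\mathbf P):=\bigoplus_{k=0}^n\mathrm{sv}(\mathbf P_k)\mathsf{Y}^k$. Then $P$ has exactly the $n$ roots $\mathrm{sv}(x_1),\ldots,\mathrm{sv}(x_n)$, counted with multiplicity: for every $r\in\mathbb{S}_{\max}^\vee$, $r$ is a root of $P$ if and only if $r=\mathrm{sv}(x_i)$ for some $i$, and $$\mathrm{mult}_r(P)=\#\{i\in\{1,\dots,n\}\mid \mathrm{sv}(x_i)=r\}.$$ In particular, for all nonzero corners $c$ of $|P|$ and all successive degrees $k<\ell$ of nonzero monomials of $P^{\mathrm{sat},c}$, either $\ell-k=1$, or $\ell-k=2$ and $P^{\mathrm{sat},c}_\ell=\ominus P^{\mathrm{sat},c}_k$; here the condition $P^{\mathrm{sat},c}_\ell=\ominus P^{\mathrm{sat},c}_k$ is equivalent to $P_\ell\odot P_k\in\mathbb{S}_{\max}^\ominus$.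 -/

import Mathlib

open Polynomial

set_option linter.unusedSectionVars false

/-! ### Semiring systems -/

/-- A (commutative) semiring system: a commutative semiring `S` with a submonoid of tangible
elements, a negation map and a surpassing relation. -/
structure SemiringSystem (S : Type*) [CommSemiring S] where
  /-- the tangible elements -/
  tangible : Submonoid S
  zero_notMem : (0 : S) ∉ tangible
  closure_tangible : AddSubmonoid.closure (tangible : Set S) = ⊤
  cancel : ∀ b ∈ tangible, ∀ a a' : S, b * a = b * a' → a = a'
  /-- the negation map `⊖` -/
  neg : S → S
  neg_neg : ∀ a, neg (neg a) = a
  neg_add : ∀ a b, neg (a + b) = neg a + neg b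
  neg_mul : ∀ a b, neg (a * b) = neg a * b
  /-- the surpassing relation -/
  surpass : S → S → Prop
  surpass_refl : ∀ a, surpass a a
  surpass_trans : ∀ a b c, surpass a b → surpass b c → surpass a c
  surpass_add : ∀ a a' b b', surpass a a' → surpass b b' → surpass (a + b) (a' + b')
  surpass_mul : ∀ a a' b b', surpass a a' → surpass b b' → surpass (a * b) (a' * b')
  surpass_neg : ∀ a a', surpass a a' → surpass (neg a) (neg a')
  zero_surpass : ∀ a, surpass 0 (a + neg a)
  eq_of_surpass : ∀ b b', (b = 0 ∨ b ∈ tangible) → (b' = 0 ∨ b' ∈ tangible) →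
    surpass b b' → b = b'
  unique_neg : ∀ b b', (b = 0 ∨ b ∈ tangible) → (b' = 0 ∨ b' ∈ tangible) →
    surpass 0 (b + neg b') → b = b'

namespace SemiringSystem

variable {S S' : Type*} [CommSemiring S] [CommSemiring S']

/-- The set `S^∨` of the elements that are zero or tangible. -/
def vee (T : SemiringSystem S) : Set S := {a | a = 0 ∨ a ∈ T.tangible}

/-- The balance relation: `a ∇ b` when `a ⊖ b` surpasses zero. -/
def Balance (T : SemiringSystem S) (a b : S) : Prop := T.surpass 0 (a + T.neg b)

/-- The balance relation for formal polynomials, coefficient by coefficient. -/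
def PolyBalance (T : SemiringSystem S) (P Q : S[X]) : Prop :=
  ∀ i, T.Balance (P.coeff i) (Q.coeff i)

/-- The formal polynomials with coefficients in `S^∨`. -/
def IsVeePoly (T : SemiringSystem S) (P : S[X]) : Prop := ∀ i, P.coeff i ∈ T.vee

/-- `a` is a root of `P` when `P(a)` surpasses zero. -/
def IsRoot (T : SemiringSystem S) (a : S) (P : S[X]) : Prop := T.surpass 0 (P.eval a)

/-- `Q` is a quotient of `P` by the linear polynomial `Y ⊖ a`: it has coefficients in `S^∨` and
`l P ∇ (Y ⊖ a) Q` for some tangible `l`. -/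
def IsQuotient (T : SemiringSystem S) (a : S) (P Q : S[X]) : Prop :=
  T.IsVeePoly Q ∧ ∃ l ∈ T.tangible, T.PolyBalance (C l * P) ((X + C (T.neg a)) * Q)

/-- `T.MultGE a k P` says that the multiplicity of `a` as a root of `P` is at least `k`. -/
def MultGE (T : SemiringSystem S) (a : S) : ℕ → S[X] → Prop
  | 0, _ => True
  | 1, P => T.IsRoot a P
  | k + 2, P => T.IsRoot a P ∧ ∃ Q, T.IsQuotient a P Q ∧ T.MultGE a (k + 1) Q

/-- The multiplicity of `a` as a root of `P`. It is zero if `a` is not a root of `P`, and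
otherwise one plus the supremum of the multiplicities of `a` in the quotients of `P` by `Y ⊖ a`;
this recursion is `SemiringSystem.mult_eq` below. -/
noncomputable def mult (T : SemiringSystem S) (a : S) (P : S[X]) : ℕ∞ :=
  ⨆ (k : ℕ) (_ : T.MultGE a k P), (k : ℕ∞)

theorem mult_eq_zero (T : SemiringSystem S) (a : S) (P : S[X]) (h : ¬ T.IsRoot a P) :
    T.mult a P = 0 := by
  refine le_antisymm (iSup₂_le fun k hk => ?_) bot_le
  match k, hk with
  | 0, _ => simp
  | 1, hk => exact absurd hk h
  | k + 2, hk => exact absurd hk.1 h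

theorem mult_eq (T : SemiringSystem S) (a : S) (P : S[X]) (h : T.IsRoot a P) :
    T.mult a P = 1 + ⨆ (Q : S[X]) (_ : T.IsQuotient a P Q), T.mult a Q := by
  apply le_antisymm
  · refine iSup₂_le fun k hk => ?_
    match k, hk with
    | 0, _ => simp
    | 1, _ => simp
    | k + 2, hk =>
      obtain ⟨-, Q, hQ, hk⟩ := hk
      have h1 : ((k + 1 : ℕ) : ℕ∞) ≤ T.mult a Q :=
        le_iSup₂_of_le (f := fun (k : ℕ) (_ : T.MultGE a k Q) => (k : ℕ∞)) (k + 1) hk le_rfl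
      have h2 : T.mult a Q ≤ ⨆ (Q : S[X]) (_ : T.IsQuotient a P Q), T.mult a Q :=
        le_iSup₂_of_le (f := fun Q (_ : T.IsQuotient a P Q) => T.mult a Q) Q hQ le_rfl
      calc ((k + 2 : ℕ) : ℕ∞) = 1 + ((k + 1 : ℕ) : ℕ∞) := by push_cast; ring
        _ ≤ _ := by gcongr; exact h1.trans h2
  · have key : ∀ k : ℕ, T.MultGE a k P → (k : ℕ∞) ≤ T.mult a P := fun k hk =>
      le_iSup₂_of_le (f := fun (k : ℕ) (_ : T.MultGE a k P) => (k : ℕ∞)) k hk le_rfl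
    have key1 : (1 : ℕ∞) ≤ T.mult a P := by simpa using key 1 h
    rcases eq_or_ne (T.mult a P) ⊤ with ht | ht
    · rw [ht]; exact le_top
    lift T.mult a P to ℕ using ht with m
    have hm : 1 ≤ m := by exact_mod_cast key1
    have : (⨆ (Q : S[X]) (_ : T.IsQuotient a P Q), T.mult a Q) ≤ ((m - 1 : ℕ) : ℕ∞) := by
      refine iSup₂_le fun Q hQ => iSup₂_le fun k hk => ?_
      match k, hk with
      | 0, _ => simp
      | k + 1, hk =>
        have : ((k + 2 : ℕ) : ℕ∞) ≤ m := key (k + 2) ⟨h, Q, hQ, hk⟩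
        have : k + 2 ≤ m := by exact_mod_cast this
        exact_mod_cast (by omega : k + 1 ≤ m - 1)
    calc (1 : ℕ∞) + _ ≤ 1 + ((m - 1 : ℕ) : ℕ∞) := by gcongr
      _ = ((1 + (m - 1) : ℕ) : ℕ∞) := by push_cast; rfl
      _ = m := by congr 1; omega

/-- Morphisms of semiring systems. -/
structure IsMorphism (T : SemiringSystem S) (T' : SemiringSystem S') (φ : S → S') : Prop where
  map_zero : φ 0 = 0
  map_tangible : ∀ b ∈ T.tangible, φ b ∈ T'.tangible
  map_neg : ∀ a, φ (T.neg a) = T'.neg (φ a)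
  map_add : ∀ a a', T'.surpass (φ (a + a')) (φ a + φ a')
  map_mul : ∀ b ∈ T.tangible, ∀ a, φ (b * a) = φ b * φ a
  map_surpass : ∀ a a', T.surpass a a' → T'.surpass (φ a) (φ a')

/-- A field as a semiring system: the tangible elements are the nonzero ones, the negation is the
usual one and the surpassing relation is equality. -/
def ofField (K : Type*) [Field K] : SemiringSystem K where
  tangible :=
    { carrier := {a | a ≠ 0}
      mul_mem' := fun ha hb => mul_ne_zero ha hb
      one_mem' := one_ne_zero }
  zero_notMem := fun h => h rfl
  closure_tangible := by
    refine eq_top_iff.2 fun a _ => ?_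
    rcases eq_or_ne a 0 with rfl | ha
    · exact zero_mem _
    · exact AddSubmonoid.subset_closure ha
  cancel := fun _ hb _ _ h => mul_left_cancel₀ hb h
  neg := fun a => -a
  neg_neg := _root_.neg_neg
  neg_add := _root_.neg_add
  neg_mul := fun a b => (_root_.neg_mul a b).symm
  surpass := fun a b => a = b
  surpass_refl := fun _ => rfl
  surpass_trans := fun _ _ _ h h' => h.trans h'
  surpass_add := by rintro _ _ _ _ rfl rfl; rfl
  surpass_mul := by rintro _ _ _ _ rfl rfl; rfl
  surpass_neg := by rintro _ _ rfl; rfl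
  zero_surpass := fun a => (add_neg_cancel a).symm
  eq_of_surpass := fun _ _ _ _ h => h
  unique_neg := fun b b' _ _ h => (sub_eq_zero.1 ((sub_eq_add_neg b b').trans h.symm))

end SemiringSystem

/-- The formal polynomial obtained by applying a map to each coefficient `P_0, …, P_n` of a
polynomial `P` of degree `n`. -/
noncomputable def coeffMap {R S : Type*} [Semiring R] [Semiring S] (f : R → S) (P : R[X]) : S[X] :=
  ∑ k ∈ Finset.range (P.natDegree + 1), monomial k (f (P.coeff k))

/-! ### The tropical semifield -/

/-- The tropical semifield `T_max(Γ) = (Γ ∪ {⊥}, max, +)`. -/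
def TMax (Γ : Type*) : Type _ := WithBot Γ

namespace TMax

variable {Γ : Type*} [AddCommGroup Γ] [LinearOrder Γ] [IsOrderedAddMonoid Γ]

instance : LinearOrder (TMax Γ) := inferInstanceAs (LinearOrder (WithBot Γ))

/-- The tropical zero is `⊥`. -/
instance : Zero (TMax Γ) := ⟨(⊥ : WithBot Γ)⟩

/-- The tropical unit is `0 : Γ`. -/
instance : One (TMax Γ) := ⟨((0 : Γ) : WithBot Γ)⟩

/-- The tropical addition is the maximum. -/
instance : Add (TMax Γ) := ⟨fun a b => max a b⟩

/-- The tropical multiplication is the addition of `Γ`, with `⊥` absorbing. -/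
instance : Mul (TMax Γ) :=
  ⟨(HAdd.hAdd : WithBot Γ → WithBot Γ → WithBot Γ)⟩

instance : CommSemiring (TMax Γ) where
  add_assoc := max_assoc (α := WithBot Γ)
  zero_add := bot_sup_eq (α := WithBot Γ)
  add_zero := sup_bot_eq (α := WithBot Γ)
  add_comm := max_comm (α := WithBot Γ)
  nsmul := nsmulRec
  mul_assoc := _root_.add_assoc (G := WithBot Γ)
  one_mul := _root_.zero_add (M := WithBot Γ)
  mul_one := _root_.add_zero (M := WithBot Γ)
  mul_comm := _root_.add_comm (G := WithBot Γ)
  zero_mul := WithBot.bot_add (α := Γ)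
  mul_zero := WithBot.add_bot (α := Γ)
  left_distrib a b c := (max_add_add_left (α := WithBot Γ) a b c).symm
  right_distrib a b c := (max_add_add_right (α := WithBot Γ) a b c).symm

/-- The tropical inverse: `g ↦ -g` on `Γ` (and `⊥ ↦ ⊥`). -/
instance : Inv (TMax Γ) := ⟨fun a => WithBot.map (fun g : Γ => -g) a⟩

/-- The inclusion of `Γ` in `T_max(Γ)`. -/
def of (g : Γ) : TMax Γ := (g : WithBot Γ)

theorem of_add_of (g h : Γ) : of g + of h = of (max g h) := (WithBot.coe_max g h).symm

/-- The corners of a formal polynomial `P` over `T_max`: a nonzero `c` is a corner if the maximum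
defining `P(c)` is attained by two different monomials of `P`; zero is a corner if `P` has no
constant term. -/
def IsCorner (P : (TMax Γ)[X]) (c : TMax Γ) : Prop :=
  (c ≠ 0 ∧ ∃ i ∈ P.support, ∃ j ∈ P.support, i ≠ j ∧
    P.coeff i * c ^ i = P.eval c ∧ P.coeff j * c ^ j = P.eval c) ∨
  (c = 0 ∧ P.coeff 0 = 0)

end TMax

/-! ### The symmetrized tropical semiring -/

/-- The nonzero elements of the symmetrized Boolean algebra: `1`, `⊖ 1` and `1° = 1 ⊖ 1`. -/
inductive BSign : Type
  | pos
  | neg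
  | bal
  deriving DecidableEq

namespace BSign

/-- Addition: idempotent, and the sum of two different elements is balanced. -/
def add (s t : BSign) : BSign := if s = t then s else bal

/-- Multiplication: the rule of signs, with `bal` absorbing. -/
def mul : BSign → BSign → BSign
  | pos, t => t
  | bal, _ => bal
  | neg, pos => neg
  | neg, neg => pos
  | neg, bal => bal

/-- Negation. -/
def opp : BSign → BSign
  | pos => neg
  | neg => pos
  | bal => bal

end BSign

/-- The symmetrized tropical semiring `S_max(Γ)`. Besides zero, its elements are the positive
elements `elt pos g`, the negative elements `elt neg g` and the balanced elements `elt bal g`, of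
modulus `g ∈ Γ`. It is the quotient of the semiring of pairs over `T_max(Γ)` by the relation that
refines the balance relation: see `SMax.mk` below. -/
inductive SMax (Γ : Type*) : Type _
  | zero : SMax Γ
  | elt (s : BSign) (g : Γ) : SMax Γ

namespace SMax

variable {Γ : Type*}

/-- The minus operator `⊖`. -/
def opp : SMax Γ → SMax Γ
  | zero => zero
  | elt s g => elt s.opp g

instance : Zero (SMax Γ) := ⟨zero⟩

theorem zero_def : (zero : SMax Γ) = 0 := rfl

theorem elt_ne_zero (s : BSign) (g : Γ) : elt s g ≠ (0 : SMax Γ) := by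
  rw [← zero_def]; simp

section add
variable [LinearOrder Γ]

/-- In a sum, the term with the larger modulus wins; for equal moduli the signs are added. -/
def add : SMax Γ → SMax Γ → SMax Γ
  | zero, b => b
  | a, zero => a
  | elt s g, elt t h => if g = h then elt (s.add t) g else if h < g then elt s g else elt t h

instance : Add (SMax Γ) := ⟨add⟩

protected theorem zero_add (a : SMax Γ) : 0 + a = a := by cases a <;> rfl

protected theorem add_zero (a : SMax Γ) : a + 0 = a := by cases a <;> rfl

theorem elt_add_elt (s t : BSign) (g h : Γ) : elt s g + elt t h =
    if g = h then elt (s.add t) g else if h < g then elt s g else elt t h := rfl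

theorem elt_add_elt_self (s t : BSign) (g : Γ) : elt s g + elt t g = elt (s.add t) g :=
  if_pos rfl

theorem elt_add_elt_of_lt (s t : BSign) {g h : Γ} (hl : g < h) :
    elt s g + elt t h = elt t h := by
  rw [elt_add_elt, if_neg hl.ne, if_neg hl.not_gt]

theorem elt_add_elt_of_gt (s t : BSign) {g h : Γ} (hl : h < g) :
    elt s g + elt t h = elt s g := by
  rw [elt_add_elt, if_neg hl.ne', if_pos hl]

protected theorem add_comm (a b : SMax Γ) : a + b = b + a := by
  rcases a with _ | ⟨s, g⟩ <;> rcases b with _ | ⟨t, h⟩ <;>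
    simp only [zero_def, SMax.zero_add, SMax.add_zero, elt_add_elt]
  have : s.add t = t.add s := by cases s <;> cases t <;> rfl
  grind

protected theorem add_assoc (a b c : SMax Γ) : a + b + c = a + (b + c) := by
  rcases a with _ | ⟨s, g⟩ <;> rcases b with _ | ⟨t, h⟩ <;> rcases c with _ | ⟨u, k⟩ <;>
    try simp only [zero_def, SMax.zero_add, SMax.add_zero]
  rcases lt_trichotomy g h with h1 | h1 | h1 <;> rcases lt_trichotomy h k with h2 | h2 | h2
  · rw [elt_add_elt_of_lt s t h1, elt_add_elt_of_lt t u h2, elt_add_elt_of_lt s u (h1.trans h2)]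
  · subst h2
    rw [elt_add_elt_of_lt s t h1, elt_add_elt_self, elt_add_elt_of_lt s _ h1]
  · rw [elt_add_elt_of_lt s t h1, elt_add_elt_of_gt t u h2, elt_add_elt_of_lt s t h1]
  · subst h1
    rw [elt_add_elt_self, elt_add_elt_of_lt _ u h2, elt_add_elt_of_lt t u h2,
      elt_add_elt_of_lt s u h2]
  · subst h1 h2
    simp only [elt_add_elt_self]
    congr 1
    cases s <;> cases t <;> cases u <;> rfl
  · subst h1
    rw [elt_add_elt_self, elt_add_elt_of_gt _ u h2, elt_add_elt_of_gt t u h2, elt_add_elt_self]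
  · rw [elt_add_elt_of_gt s t h1, elt_add_elt_of_lt t u h2]
  · subst h2
    rw [elt_add_elt_of_gt s t h1, elt_add_elt_self, elt_add_elt_of_gt s u h1,
      elt_add_elt_of_gt s _ h1]
  · rw [elt_add_elt_of_gt s t h1, elt_add_elt_of_gt t u h2, elt_add_elt_of_gt s u (h2.trans h1),
      elt_add_elt_of_gt s t h1]

end add

section mul
variable [AddCommGroup Γ]

/-- Signs are multiplied and moduli are added in `Γ`. -/
def mul : SMax Γ → SMax Γ → SMax Γ
  | zero, _ => zero
  | _, zero => zero
  | elt s g, elt t h => elt (s.mul t) (g + h)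

instance : One (SMax Γ) := ⟨elt BSign.pos 0⟩

instance : Mul (SMax Γ) := ⟨mul⟩

theorem one_def : (1 : SMax Γ) = elt BSign.pos 0 := rfl

protected theorem zero_mul (a : SMax Γ) : 0 * a = 0 := by cases a <;> rfl

protected theorem mul_zero (a : SMax Γ) : a * 0 = 0 := by cases a <;> rfl

theorem elt_mul_elt (s t : BSign) (g h : Γ) : elt s g * elt t h = elt (s.mul t) (g + h) := rfl

protected theorem mul_comm (a b : SMax Γ) : a * b = b * a := by
  rcases a with _ | ⟨s, g⟩ <;> rcases b with _ | ⟨t, h⟩ <;>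
    simp only [zero_def, SMax.zero_mul, SMax.mul_zero, elt_mul_elt]
  rw [show s.mul t = t.mul s by cases s <;> cases t <;> rfl, add_comm g h]

protected theorem mul_assoc (a b c : SMax Γ) : a * b * c = a * (b * c) := by
  rcases a with _ | ⟨s, g⟩ <;> rcases b with _ | ⟨t, h⟩ <;> rcases c with _ | ⟨u, k⟩ <;>
    simp only [zero_def, SMax.zero_mul, SMax.mul_zero, elt_mul_elt]
  rw [show (s.mul t).mul u = s.mul (t.mul u) by cases s <;> cases t <;> cases u <;> rfl,
    add_assoc g h k]

end mul

section ordered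
variable [AddCommGroup Γ] [LinearOrder Γ] [IsOrderedAddMonoid Γ]

protected theorem mul_add (a b c : SMax Γ) : a * (b + c) = a * b + a * c := by
  rcases a with _ | ⟨s, g⟩ <;> rcases b with _ | ⟨t, h⟩ <;> rcases c with _ | ⟨u, k⟩ <;>
    simp only [zero_def, SMax.zero_mul, SMax.mul_zero, SMax.zero_add, SMax.add_zero, elt_mul_elt,
      elt_add_elt, add_right_inj, add_lt_add_iff_left]
  have : s.mul (t.add u) = (s.mul t).add (s.mul u) := by cases s <;> cases t <;> cases u <;> rfl
  split_ifs <;> simp [elt_mul_elt, this]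

instance : CommSemiring (SMax Γ) where
  add_assoc := SMax.add_assoc
  zero_add := SMax.zero_add
  add_zero := SMax.add_zero
  add_comm := SMax.add_comm
  nsmul := nsmulRec
  mul_assoc := SMax.mul_assoc
  one_mul a := by
    rcases a with _ | ⟨s, g⟩
    · rfl
    · rw [one_def, elt_mul_elt, zero_add]; rfl
  mul_one a := by
    rcases a with _ | ⟨s, g⟩
    · rfl
    · rw [one_def, elt_mul_elt, add_zero]; cases s <;> rfl
  mul_comm := SMax.mul_comm
  zero_mul := SMax.zero_mul
  mul_zero := SMax.mul_zero
  left_distrib := SMax.mul_add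
  right_distrib a b c := by
    rw [SMax.mul_comm, SMax.mul_add, SMax.mul_comm c a, SMax.mul_comm c b]

/-- The set `S_max^⊖` of the negative or zero elements. -/
def IsNegative : SMax Γ → Prop
  | zero => True
  | elt s _ => s = BSign.neg

/-- The set `S_max^⊕` of the positive or zero elements. -/
def IsPositive : SMax Γ → Prop
  | zero => True
  | elt s _ => s = BSign.pos

/-- The set `S_max^∘` of the balanced elements (zero included). -/
def IsBalanced : SMax Γ → Prop
  | zero => True
  | elt s _ => s = BSign.bal

/-- The signed elements `S_max^∨`: positive, negative or zero. -/
def IsSigned (a : SMax Γ) : Prop := a.IsPositive ∨ a.IsNegative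

/-- The relation `a ≼° b`: `b` is the sum of `a` and a balanced element. -/
def Surpass (a b : SMax Γ) : Prop := ∃ c : SMax Γ, c.IsBalanced ∧ b = a + c

theorem isBalanced_add {a b : SMax Γ} (ha : a.IsBalanced) (hb : b.IsBalanced) :
    (a + b).IsBalanced := by
  rcases a with _ | ⟨s, g⟩ <;> rcases b with _ | ⟨t, h⟩ <;>
    simp only [zero_def, SMax.zero_add, SMax.add_zero, elt_add_elt] <;> try assumption
  cases ha; cases hb
  split_ifs <;> rfl

theorem isBalanced_mul {a b : SMax Γ} (ha : a.IsBalanced) : (a * b).IsBalanced := by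
  rcases a with _ | ⟨s, g⟩ <;> rcases b with _ | ⟨t, h⟩ <;> try exact trivial
  cases ha; rfl

theorem isBalanced_add_opp (a : SMax Γ) : (a + a.opp).IsBalanced := by
  rcases a with _ | ⟨s, g⟩
  · trivial
  · simp only [opp, elt_add_elt, if_true]
    cases s <;> rfl

protected theorem opp_add (a b : SMax Γ) : (a + b).opp = a.opp + b.opp := by
  rcases a with _ | ⟨s, g⟩ <;> rcases b with _ | ⟨t, h⟩ <;> try rfl
  have : (s.add t).opp = s.opp.add t.opp := by cases s <;> cases t <;> rfl
  simp only [opp, elt_add_elt]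
  split_ifs <;> simp [this]

theorem eq_of_surpass {a b : SMax Γ} (hb : b.IsSigned) (h : a.Surpass b) (h0 : a.IsSigned) :
    a = b := by
  obtain ⟨c, hc, rfl⟩ := h
  rcases a with _ | ⟨s, g⟩ <;> rcases c with _ | ⟨t, h⟩ <;>
    simp only [zero_def, SMax.zero_add, SMax.add_zero, elt_add_elt] at hb ⊢ <;>
    simp only [IsSigned, IsPositive, IsNegative, IsBalanced] at hb hc h0 ⊢
  · subst hc; simp at hb
  · subst hc
    split_ifs at hb ⊢ with h1 h2 <;>
      rcases h0 with rfl | rfl <;> simp [BSign.add] at hb ⊢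

theorem eq_of_isBalanced_add_opp {a b : SMax Γ} (ha : a.IsSigned) (hb : b.IsSigned)
    (h : (a + b.opp).IsBalanced) : a = b := by
  rcases a with _ | ⟨s, g⟩ <;> rcases b with _ | ⟨t, k⟩ <;>
    simp only [zero_def, opp, SMax.zero_add, SMax.add_zero, elt_add_elt] at h ⊢ <;>
    simp only [IsSigned, IsPositive, IsNegative] at ha hb
  · simp only [IsBalanced] at h
    rcases hb with rfl | rfl <;> cases h
  · simp only [IsBalanced] at h
    rcases ha with rfl | rfl <;> cases h
  · split_ifs at h with h1 h2 <;> simp only [IsBalanced] at h <;>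
      rcases ha with rfl | rfl <;> rcases hb with rfl | rfl <;>
      simp_all [BSign.add, BSign.opp]

/-- The symmetrized tropical semiring as a semiring system: the tangible elements are the nonzero
signed elements, the negation is `⊖` and the surpassing relation is `≼°`. -/
def system (Γ : Type*) [AddCommGroup Γ] [LinearOrder Γ] [IsOrderedAddMonoid Γ] :
    SemiringSystem (SMax Γ) where
  tangible :=
    { carrier := {a | a.IsSigned ∧ a ≠ 0}
      mul_mem' := by
        rintro (_ | ⟨s, g⟩) (_ | ⟨t, h⟩) ⟨ha, ha0⟩ ⟨hb, hb0⟩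
        · exact absurd rfl ha0
        · exact absurd rfl ha0
        · exact absurd rfl hb0
        · refine ⟨?_, elt_ne_zero _ _⟩
          rw [elt_mul_elt]
          rcases ha with ha | ha <;> rcases hb with hb | hb <;> cases ha <;> cases hb
          exacts [Or.inl rfl, Or.inr rfl, Or.inr rfl, Or.inl rfl]
      one_mem' := ⟨Or.inl rfl, elt_ne_zero _ _⟩ }
  zero_notMem := fun h => h.2 rfl
  closure_tangible := by
    refine eq_top_iff.2 fun a _ => ?_
    have hp : ∀ g : Γ, elt BSign.pos g ∈ AddSubmonoid.closure
        {a : SMax Γ | a.IsSigned ∧ a ≠ 0} := fun g =>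
      AddSubmonoid.subset_closure ⟨Or.inl rfl, elt_ne_zero _ _⟩
    have hn : ∀ g : Γ, elt BSign.neg g ∈ AddSubmonoid.closure
        {a : SMax Γ | a.IsSigned ∧ a ≠ 0} := fun g =>
      AddSubmonoid.subset_closure ⟨Or.inr rfl, elt_ne_zero _ _⟩
    rcases a with _ | ⟨_ | _ | _, g⟩
    · exact zero_mem _
    · exact hp g
    · exact hn g
    · have h := add_mem (hp g) (hn g)
      rwa [elt_add_elt, if_pos rfl] at h
  cancel := by
    rintro (_ | ⟨s, g⟩) ⟨hb, hb0⟩ (_ | ⟨t, h⟩) (_ | ⟨u, k⟩) e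
    · rfl
    · exact absurd rfl hb0
    · exact absurd rfl hb0
    · exact absurd rfl hb0
    · rfl
    · exact absurd e.symm (elt_ne_zero _ _)
    · exact absurd e (elt_ne_zero _ _)
    · simp only [elt_mul_elt, elt.injEq, add_right_inj] at e ⊢
      refine ⟨?_, e.2⟩
      have e1 := e.1
      rcases hb with hb | hb <;> cases hb
      · exact e1
      · cases t <;> cases u <;> first | rfl | exact absurd e1 (by decide)
  neg := opp
  neg_neg := by rintro (_ | ⟨_ | _ | _, g⟩) <;> rfl
  neg_add := SMax.opp_add
  neg_mul := by rintro (_ | ⟨_ | _ | _, g⟩) (_ | ⟨_ | _ | _, h⟩) <;> rfl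
  surpass := Surpass
  surpass_refl := fun a => ⟨0, trivial, (add_zero a).symm⟩
  surpass_trans := by
    rintro a _ _ ⟨c, hc, rfl⟩ ⟨d, hd, rfl⟩
    exact ⟨c + d, isBalanced_add hc hd, add_assoc a c d⟩
  surpass_add := by
    rintro a _ b _ ⟨c, hc, rfl⟩ ⟨d, hd, rfl⟩
    exact ⟨c + d, isBalanced_add hc hd, add_add_add_comm a c b d⟩
  surpass_mul := by
    rintro a _ b _ ⟨c, hc, rfl⟩ ⟨d, hd, rfl⟩
    exact ⟨d * a + c * (b + d), isBalanced_add (isBalanced_mul hd) (isBalanced_mul hc), by ring⟩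
  surpass_neg := by
    rintro a _ ⟨c, hc, rfl⟩
    refine ⟨c.opp, ?_, SMax.opp_add a c⟩
    rcases c with _ | ⟨s, g⟩
    · trivial
    · cases hc; rfl
  zero_surpass := fun a => ⟨a + a.opp, isBalanced_add_opp a, (zero_add _).symm⟩
  eq_of_surpass := by
    have key : ∀ b : SMax Γ, (b = 0 ∨ b.IsSigned ∧ b ≠ 0) → b.IsSigned := by
      rintro b (rfl | h)
      exacts [Or.inl trivial, h.1]
    exact fun b b' hb hb' h => eq_of_surpass (key b' hb') h (key b hb)
  unique_neg := by
    have key : ∀ b : SMax Γ, (b = 0 ∨ b.IsSigned ∧ b ≠ 0) → b.IsSigned := by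
      rintro b (rfl | h)
      exacts [Or.inl trivial, h.1]
    rintro b b' hb hb' ⟨c, hc, h⟩
    rw [SMax.zero_add] at h
    exact eq_of_isBalanced_add_opp (key b hb) (key b' hb') (h ▸ hc)

/-! #### Modulus and saturation -/

/-- The absolute value (modulus), a morphism of semirings from `S_max` to `T_max`. -/
def modulus : SMax Γ →+* TMax Γ where
  toFun
    | zero => 0
    | elt _ g => TMax.of g
  map_zero' := rfl
  map_one' := rfl
  map_add' := by
    rintro (_ | ⟨s, g⟩) (_ | ⟨t, h⟩)
    · exact (add_zero 0).symm
    · exact (zero_add _).symm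
    · exact (add_zero _).symm
    · rw [elt_add_elt, TMax.of_add_of]
      split_ifs with h1 h2
      · rw [h1, max_self]
      · rw [max_eq_left h2.le]
      · rw [max_eq_right (not_lt.1 h2)]
  map_mul' := by
    rintro (_ | ⟨s, g⟩) (_ | ⟨t, h⟩)
    · exact (zero_mul 0).symm
    · exact (zero_mul _).symm
    · exact (mul_zero _).symm
    · rfl

/-- The embedding of `T_max` in `S_max` as the set of positive or zero elements. -/
def ofTMax (a : TMax Γ) : SMax Γ := WithBot.recBotCoe (0 : SMax Γ) (elt BSign.pos) a

/-- The saturation set `sat(r, P)`: the indices `i ∈ {0, …, deg P}` with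
`|P(r)| = |P_i| |r|^i`. -/
def sat (r : SMax Γ) (P : (SMax Γ)[X]) : Set ℕ :=
  {i | i ≤ P.natDegree ∧ modulus (P.eval r) = modulus (P.coeff i) * modulus r ^ i}

open Classical in
/-- The saturation polynomial `P^{sat,r}`: the sum over `i ∈ sat(r, P)` of the monomials
`|P(r)|⁻¹ r^i P_i Y^i`. -/
noncomputable def satPoly (r : SMax Γ) (P : (SMax Γ)[X]) : (SMax Γ)[X] :=
  ∑ i ∈ Finset.range (P.natDegree + 1) with i ∈ sat r P,
    monomial i (ofTMax (modulus (P.eval r))⁻¹ * r ^ i * P.coeff i)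

/-! #### The construction as a quotient -/

/-- The class in `S_max` of a pair `(a, b)` over `T_max`, thought of as `a ⊖ b`. -/
def mk (a b : TMax Γ) : SMax Γ := ofTMax a + (ofTMax b).opp

theorem ofTMax_add (a b : TMax Γ) : ofTMax (a + b) = ofTMax a + ofTMax b := by
  induction a using WithBot.recBotCoe with
  | bot => exact (congrArg ofTMax (zero_add b)).trans (zero_add _).symm
  | coe g =>
    induction b using WithBot.recBotCoe with
    | bot => exact (congrArg ofTMax (add_zero _)).trans (add_zero _).symm
    | coe h =>
      change ofTMax (TMax.of g + TMax.of h) = elt BSign.pos g + elt BSign.pos h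
      rw [TMax.of_add_of, elt_add_elt]
      change elt BSign.pos (max g h) = _
      split_ifs with h1 h2
      · rw [h1, max_self]; rfl
      · rw [max_eq_left h2.le]
      · rw [max_eq_right (not_lt.1 h2)]

theorem ofTMax_mul (a b : TMax Γ) : ofTMax (a * b) = ofTMax a * ofTMax b := by
  induction a using WithBot.recBotCoe with
  | bot => exact (congrArg ofTMax (zero_mul b)).trans (zero_mul _).symm
  | coe g =>
    induction b using WithBot.recBotCoe with
    | bot => exact (congrArg ofTMax (mul_zero _)).trans (mul_zero _).symm
    | coe h => rfl

theorem mk_zero_zero : mk (0 : TMax Γ) 0 = 0 := rfl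

theorem mk_one_zero : mk (1 : TMax Γ) 0 = 1 := rfl

theorem mk_opp (a b : TMax Γ) : (mk a b).opp = mk b a := by
  rw [mk, mk, SMax.opp_add, add_comm]
  exact congrArg (· + _) ((system Γ).neg_neg (ofTMax b))

theorem mk_add (a b a' b' : TMax Γ) : mk (a + a') (b + b') = mk a b + mk a' b' := by
  simp only [mk, ofTMax_add, SMax.opp_add]
  exact add_add_add_comm _ _ _ _

theorem mk_mul (a b a' b' : TMax Γ) :
    mk (a * a' + b * b') (a * b' + b * a') = mk a b * mk a' b' := by
  have h1 : ∀ x y : SMax Γ, (x * y).opp = x.opp * y := (system Γ).neg_mul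
  have h2 : ∀ x y : SMax Γ, (x * y).opp = x * y.opp := fun x y => by
    rw [mul_comm, h1, mul_comm]
  have h3 : ∀ x y : SMax Γ, x.opp * y.opp = x * y := fun x y => by
    rw [← h1, ← h2]; exact (system Γ).neg_neg _
  simp only [mk, ofTMax_add, ofTMax_mul, SMax.opp_add, add_mul, mul_add, h3]
  rw [h2, h1]
  abel

theorem mk_surjective (x : SMax Γ) : ∃ a b : TMax Γ, mk a b = x := by
  rcases x with _ | ⟨_ | _ | _, g⟩
  · exact ⟨0, 0, rfl⟩
  · exact ⟨TMax.of g, 0, rfl⟩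
  · exact ⟨0, TMax.of g, rfl⟩
  · exact ⟨TMax.of g, TMax.of g, by
      change elt BSign.pos g + elt BSign.neg g = _
      rw [elt_add_elt, if_pos rfl]; rfl⟩

theorem mk_of_of (g h : Γ) : mk (TMax.of g) (TMax.of h) =
    if g = h then elt BSign.bal g else if h < g then elt BSign.pos g else elt BSign.neg h := rfl

/-- Two pairs have the same class in `S_max` exactly when they are equivalent for the relation
that refines the balance relation. -/
theorem mk_eq_mk_iff (a b a' b' : TMax Γ) : mk a b = mk a' b' ↔
    (a ≠ b ∧ a' ≠ b' ∧ a + b' = b + a') ∨ (¬ (a ≠ b ∧ a' ≠ b') ∧ a = a' ∧ b = b') := by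
  have h1 : ∀ g : Γ, mk (TMax.of g) 0 = elt BSign.pos g := fun _ => rfl
  have h2 : ∀ g : Γ, mk 0 (TMax.of g) = elt BSign.neg g := fun _ => rfl
  have h3 : ∀ g : Γ, TMax.of g ≠ 0 := fun _ => WithBot.coe_ne_bot
  have h4 : ∀ g h : Γ, TMax.of g = TMax.of h ↔ g = h := fun _ _ => WithBot.coe_inj
  have h5 : ∀ a : TMax Γ, a = 0 ∨ ∃ g, a = TMax.of g := fun a => by
    induction a using WithBot.recBotCoe with
    | bot => exact Or.inl rfl
    | coe g => exact Or.inr ⟨g, rfl⟩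
  have h6 : ∀ (s : BSign) (g : Γ), elt s g ≠ 0 := elt_ne_zero
  rcases h5 a with rfl | ⟨g, rfl⟩ <;> rcases h5 b with rfl | ⟨h, rfl⟩ <;>
    rcases h5 a' with rfl | ⟨g', rfl⟩ <;> rcases h5 b' with rfl | ⟨h', rfl⟩ <;>
    simp only [mk_of_of, h1, h2, mk_zero_zero, TMax.of_add_of, zero_add, add_zero, h4, ne_eq] <;>
    grind

end ordered
end SMax

/-! The multiplicity of `r` is squeezed between two bounds. From below, the factors `Y - x_i` with
`sv (x_i) = r` are split off one at a time: applying `sv` to the coefficients turns each exact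
division into a quotient in the sense of the definition of multiplicity (`multGE_countP`). From
above, for `r ≠ 0`, Descartes' rule applies. Only the signs of the monomials of largest modulus at
`r` are kept. After the substitution `Y → rY`, a quotient by `Y ⊖ r` becomes a quotient by `Y - 1`
over the hyperfield of signs, which has at least one sign change fewer (`signChanges_succ_le`); so
the multiplicity is at most the number of sign changes (`exists_le_signChanges_of_multGE`).

The bounds coincide because `r` and `⊖ r` are counted together. The sign sequence at `⊖ r` is the
one at `r` twisted by `(-1)^i`, and the sign changes of a sequence and of its twist add up to at
most `E - F`, the distance between the extreme nonzero terms (`signChanges_add_twist_le_sub`). Here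
`E - F` is the length of an edge of the Newton polygon, that is, the number of `x_i` of modulus
`|r|` (`exists_isEdge`), hence the number of those above `r` plus those above `⊖ r`. The two lower
bounds already fill this length, so every inequality is an equality (`descartes_sharp`). For `r =
0`, multiplicity `k` forces `Y^k` to divide the polynomial.

The statement on gaps is the equality case (`gap_of_signChanges_eq`): between successive nonzero
indices `k < l` the two sequences gain at most two sign changes in total, and sharpness demands at
least `l - k`. -/

/-! ### Sign sequences -/

/-- The last nonzero term among `α 0, …, α n` (zero if there is none). -/
def lastSign (α : ℕ → SignType) : ℕ → SignType
  | 0 => α 0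
  | n + 1 => if α (n + 1) = 0 then lastSign α n else α (n + 1)

/-- The number of sign changes in `α 0, …, α n`, zeros being ignored. -/
def signChanges (α : ℕ → SignType) : ℕ → ℕ
  | 0 => 0
  | n + 1 => signChanges α n + if α (n + 1) ≠ 0 ∧ α (n + 1) = -lastSign α n then 1 else 0

/-- `α` belongs to the difference of `β` and `β'` in the hyperfield of signs. -/
def SignBal (α β β' : SignType) : Prop :=
  if β = β' then (β = 0 → α = 0) else if β = 0 then α = -β' else α = β

instance (α β β' : SignType) : Decidable (SignBal α β β') := by
  unfold SignBal; infer_instance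

theorem signChanges_mono (α : ℕ → SignType) : Monotone (signChanges α) :=
  monotone_nat_of_le_succ fun _ => Nat.le_add_right _ _

theorem lastSign_of_ne_zero {α : ℕ → SignType} {n : ℕ} (h : α n ≠ 0) : lastSign α n = α n := by
  cases n with
  | zero => rfl
  | succ n => simp [lastSign, h]

theorem lastSign_ne_zero {α : ℕ → SignType} {i n : ℕ} (hi : i ≤ n) (h : α i ≠ 0) :
    lastSign α n ≠ 0 := by
  induction n, hi using Nat.le_induction with
  | base => rwa [lastSign_of_ne_zero h]
  | succ n _ ih =>
    rw [lastSign]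
    split_ifs with h1
    exacts [ih, h1]

theorem lastSign_eq_of_zero_between {α : ℕ → SignType} {k n : ℕ} (hk : k ≤ n)
    (h : ∀ i, k < i → i ≤ n → α i = 0) :
    lastSign α n = lastSign α k ∧ signChanges α n = signChanges α k := by
  induction n, hk using Nat.le_induction with
  | base => exact ⟨rfl, rfl⟩
  | succ n hn ih =>
    have h1 := h (n + 1) (by omega) le_rfl
    have := ih fun i hi hin => h i hi (by omega)
    simp [lastSign, signChanges, h1, this]

theorem signChanges_eq_zero_of_zero_before {α : ℕ → SignType} {n : ℕ} (h : ∀ i < n, α i = 0) :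
    signChanges α n = 0 := by
  cases n with
  | zero => rfl
  | succ n =>
    have h0 : α 0 = 0 := h 0 (by omega)
    obtain ⟨h1, h2⟩ := lastSign_eq_of_zero_between (α := α) (Nat.zero_le n)
      fun i _ hi => h i (by omega)
    simp [signChanges, h1, h2, lastSign, h0]

theorem eq_lastSign_of_signChanges_eq_zero {α : ℕ → SignType} {n : ℕ} (h : signChanges α n = 0) :
    ∀ i ≤ n, α i = 0 ∨ α i = lastSign α n := by
  induction n with
  | zero => intro i hi; right; rw [Nat.le_zero.1 hi]; rfl
  | succ n ih =>
    rw [signChanges] at h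
    have ih := ih (by omega)
    have h2 : ¬ (α (n + 1) ≠ 0 ∧ α (n + 1) = -lastSign α n) := fun h' => by
      rw [if_pos h'] at h; omega
    intro i hi
    rcases Nat.lt_or_ge i (n + 1) with hi' | hi'
    · have h3 := ih i (by omega)
      rw [lastSign]
      revert h2 h3
      generalize α i = a, α (n + 1) = b, lastSign α n = c
      revert a b c
      decide
    · obtain rfl : i = n + 1 := by omega
      rw [lastSign]
      split_ifs with h3
      exacts [Or.inl h3, Or.inr rfl]

theorem exists_one_le_signChanges {α : ℕ → SignType} {i j : ℕ} (hi : α i = 1) (hj : α j = -1) :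
    ∃ n, 1 ≤ signChanges α n := by
  refine ⟨max i j, ?_⟩
  by_contra! h
  have h1 := eq_lastSign_of_signChanges_eq_zero (Nat.lt_one_iff.1 h)
  have hi' := h1 i (le_max_left _ _)
  have hj' := h1 j (le_max_right _ _)
  rw [hi] at hi'
  rw [hj] at hj'
  revert hi' hj'
  generalize lastSign α _ = s
  revert s
  decide

theorem lastSign_mul (s : SignType) (hs : s ≠ 0) (α : ℕ → SignType) (n : ℕ) :
    lastSign (fun i => s * α i) n = s * lastSign α n := by
  induction n with
  | zero => rfl
  | succ n ih => simp only [lastSign, ih, mul_eq_zero, hs, false_or]; split_ifs <;> rfl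

theorem signChanges_mul (s : SignType) (hs : s ≠ 0) (α : ℕ → SignType) (n : ℕ) :
    signChanges (fun i => s * α i) n = signChanges α n := by
  induction n with
  | zero => rfl
  | succ n ih =>
    simp only [signChanges, ih, lastSign_mul s hs]
    have key : ∀ s a b : SignType, s ≠ 0 →
        ((s * a ≠ 0 ∧ s * a = -(s * b)) ↔ (a ≠ 0 ∧ a = -b)) := by decide
    rw [if_congr (key s _ _ hs) rfl rfl]

/-- Think of `α` as the coefficients of `(Y - 1) β`. When `β` drops from a nonzero term to zero, or
takes a new sign, `α` takes the sign that `β` leaves. So `α` keeps up with each change of `β`, and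
is one change ahead whenever the last signs agree; this extra term is what lets the induction close.
-/
theorem signChanges_invariant {α β : ℕ → SignType} (h0 : SignBal (α 0) 0 (β 0))
    (h : ∀ n, SignBal (α (n + 1)) (β n) (β (n + 1))) (n : ℕ) :
    (lastSign β n = 0 → β n = 0 ∧ lastSign α n = 0 ∧ signChanges β n = 0) ∧
    (lastSign β n ≠ 0 → (β n = 0 ∨ β n = lastSign β n) ∧ lastSign α n ≠ 0 ∧
      (β n = 0 → lastSign α n = lastSign β n) ∧
      signChanges β n + (if lastSign α n = lastSign β n then 1 else 0) ≤ signChanges α n) := by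
  induction n with
  | zero =>
    have key : ∀ a b : SignType, SignBal a 0 b → (b = 0 → b = 0 ∧ a = 0 ∧ 0 = 0) ∧
        (b ≠ 0 → (b = 0 ∨ b = b) ∧ a ≠ 0 ∧ (b = 0 → a = b) ∧
          (0 + if a = b then 1 else 0) ≤ 0) := by
      intro a b
      cases a <;> cases b <;> simp [SignBal]
    exact key _ _ h0
  | succ n ih =>
    have h1 := h n
    -- The step involves only five signs and two counters: `B` and `A` are the last signs of `β` and
    -- `α`, `v` and `u` their sign changes. A finite check suffices.
    have key : ∀ (a b b' B A : SignType) (u v : ℕ),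
        ((B = 0 → b' = 0 ∧ A = 0 ∧ v = 0) ∧
          (B ≠ 0 → (b' = 0 ∨ b' = B) ∧ A ≠ 0 ∧ (b' = 0 → A = B) ∧
            (v + if A = B then 1 else 0) ≤ u)) → SignBal a b' b →
        ∀ A' B', A' = (if a = 0 then A else a) → B' = (if b = 0 then B else b) →
        (B' = 0 → b = 0 ∧ A' = 0 ∧ (v + if b ≠ 0 ∧ b = -B then 1 else 0) = 0) ∧
        (B' ≠ 0 → (b = 0 ∨ b = B') ∧ A' ≠ 0 ∧ (b = 0 → A' = B') ∧
          (v + if b ≠ 0 ∧ b = -B then 1 else 0) + (if A' = B' then 1 else 0) ≤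
            u + if a ≠ 0 ∧ a = -A then 1 else 0) := by
      rintro a b b' B A u v h1 h2 A' B' rfl rfl
      revert h1 h2
      cases B <;> cases b' <;> cases b <;> cases A <;> cases a <;> simp [SignBal] <;> omega
    exact key _ _ _ _ _ _ _ ih h1 _ _ rfl rfl

/-- Descartes' bound in the hyperfield of signs: multiplication by `Y - 1` creates a new sign
change. -/
theorem signChanges_succ_le {α β : ℕ → SignType} (h0 : SignBal (α 0) 0 (β 0))
    (h : ∀ n, SignBal (α (n + 1)) (β n) (β (n + 1))) {i n : ℕ} (hi : i ≤ n) (hβi : β i ≠ 0)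
    (hβn : β n = 0) : signChanges β n + 1 ≤ signChanges α n := by
  obtain ⟨-, h1⟩ := signChanges_invariant h0 h n
  obtain ⟨-, -, h2, h3⟩ := h1 (lastSign_ne_zero hi hβi)
  rwa [if_pos (h2 hβn)] at h3

/-- The sequence of the signs of the coefficients of `P(-Y)`. -/
def twist (α : ℕ → SignType) (n : ℕ) : SignType := (-1) ^ n * α n

theorem twist_ne_zero {α : ℕ → SignType} {n : ℕ} : twist α n ≠ 0 ↔ α n ≠ 0 := by
  have : ((-1 : SignType) ^ n) ≠ 0 := pow_ne_zero _ (by decide)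
  simp [twist, this]

theorem twist_eq_zero {α : ℕ → SignType} {n : ℕ} : twist α n = 0 ↔ α n = 0 :=
  not_iff_not.1 twist_ne_zero

/-- `L` is the position of the last nonzero term. Across an odd gap, twisting reverses the relative
sign of the two terms, so only one of the sequences can change; across an even gap both can, but the
gap is then at least two. -/
theorem signChanges_step {α : ℕ → SignType} {L j : ℕ} (hL : L ≤ j) (hj : α (j + 1) ≠ 0)
    (h1 : lastSign α j = α L) (h2 : lastSign (twist α) j = twist α L) :
    signChanges α (j + 1) + signChanges (twist α) (j + 1) + L ≤
      signChanges α j + signChanges (twist α) j + (j + 1) := by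
  have key : ¬ Even (j + 1 - L) →
      ¬ (α (j + 1) = -α L ∧ twist α (j + 1) = -twist α L) := by
    rintro he ⟨e1, e2⟩
    obtain ⟨d, hd⟩ : ∃ d, j + 1 = L + d := ⟨j + 1 - L, by omega⟩
    rw [show j + 1 - L = d by omega, Nat.not_even_iff_odd] at he
    unfold twist at e2
    rw [e1] at hj e2
    rw [hd, pow_add, he.neg_one_pow] at e2
    rcases neg_one_pow_eq_or SignType L with h | h <;> rw [h] at e2 <;> revert e2 hj <;>
      generalize α L = a <;> revert a <;> decide
  simp only [signChanges, h1, h2]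
  by_cases he : Even (j + 1 - L)
  · have : 2 ≤ j + 1 - L := by obtain ⟨t, ht⟩ := he; omega
    split_ifs <;> omega
  · have := key he
    split_ifs with c1 c2
    · exact absurd ⟨c1.2, c2.2⟩ this
    all_goals omega

/-- The total number of changes minus the position of the last nonzero term never increases. The
starting point `k` is left free so that the count can be cut at any nonzero term. -/
theorem signChanges_add_twist_le {α : ℕ → SignType} {k j : ℕ} (hk : α k ≠ 0) (hkj : k ≤ j) :
    ∃ L, k ≤ L ∧ L ≤ j ∧ α L ≠ 0 ∧ lastSign α j = α L ∧ lastSign (twist α) j = twist α L ∧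
      signChanges α j + signChanges (twist α) j + k ≤
        signChanges α k + signChanges (twist α) k + L := by
  induction j, hkj using Nat.le_induction with
  | base =>
    exact ⟨k, le_rfl, le_rfl, hk, lastSign_of_ne_zero hk,
      lastSign_of_ne_zero (twist_ne_zero.2 hk), le_rfl⟩
  | succ j hj ih =>
    obtain ⟨L, hkL, hLj, hL, h1, h2, h3⟩ := ih
    by_cases h0 : α (j + 1) = 0
    · have h0' : twist α (j + 1) = 0 := twist_eq_zero.2 h0
      exact ⟨L, hkL, by omega, hL, by simp [lastSign, h0, h1], by simp [lastSign, h0', h2],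
        by simpa [signChanges, h0, h0'] using h3⟩
    · have := signChanges_step hLj h0 h1 h2
      exact ⟨j + 1, by omega, le_rfl, h0, lastSign_of_ne_zero h0,
        lastSign_of_ne_zero (twist_ne_zero.2 h0), by omega⟩

/-- The sign changes of `P(Y)` and `P(-Y)` are at most as many as the difference between the
degrees of the extreme monomials. -/
theorem signChanges_add_twist_le_sub {α : ℕ → SignType} {F E : ℕ} (hF : α F ≠ 0)
    (h1 : ∀ i < F, α i = 0) (h2 : ∀ i, E < i → α i = 0) (j : ℕ) :
    signChanges α j + signChanges (twist α) j + F ≤ E := by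
  have hFE : F ≤ E := not_lt.1 fun h => hF (h2 F h)
  obtain ⟨L, -, -, hL, -, -, h⟩ := signChanges_add_twist_le hF (le_max_right j F)
  have e1 := signChanges_eq_zero_of_zero_before h1
  have e2 := signChanges_eq_zero_of_zero_before (α := twist α) fun i hi =>
    twist_eq_zero.2 (h1 i hi)
  -- The index `j` may lie before `F`; monotonicity transfers the bound from `max j F` to `j`.
  have hLE : L ≤ E := not_lt.1 fun h => hL (h2 L h)
  have m1 := signChanges_mono α (le_max_left j F)
  have m2 := signChanges_mono (twist α) (le_max_left j F)
  omega

/-- When the bound is attained, two successive nonzero terms are adjacent, or they have opposite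
signs and are separated by one zero. -/
theorem gap_of_signChanges_eq {α : ℕ → SignType} {F E j : ℕ} (hF : α F ≠ 0)
    (h1 : ∀ i < F, α i = 0) (h2 : ∀ i, E < i → α i = 0)
    (heq : E ≤ signChanges α j + signChanges (twist α) j + F) {k l : ℕ} (hkl : k < l)
    (hk : α k ≠ 0) (hl : α l ≠ 0) (h0 : ∀ i, k < i → i < l → α i = 0) :
    l = k + 1 ∨ (l = k + 2 ∧ α l = -α k) := by
  have e1 := signChanges_eq_zero_of_zero_before h1
  have e2 := signChanges_eq_zero_of_zero_before (α := twist α) fun i hi =>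
    twist_eq_zero.2 (h1 i hi)
  have hFk : F ≤ k := not_lt.1 fun h => hk (h1 k h)
  -- Up to `k` at most `k - F` changes occur, and after `l` at most `E - l`. Equality therefore
  -- requires at least `l - k` changes in the single passage from `k` to `l`.
  obtain ⟨L1, -, hL1, -, -, -, i1⟩ := signChanges_add_twist_le hF hFk
  obtain ⟨L2, -, -, hL2, -, -, i2⟩ := signChanges_add_twist_le hl (le_max_right j l)
  have hLE : L2 ≤ E := not_lt.1 fun h => hL2 (h2 L2 h)
  have m1 := signChanges_mono α (le_max_left j l)
  have m2 := signChanges_mono (twist α) (le_max_left j l)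
  obtain ⟨m, rfl⟩ : ∃ m, l = m + 1 := ⟨l - 1, by omega⟩
  obtain ⟨a1, a2⟩ := lastSign_eq_of_zero_between (α := α) (show k ≤ m by omega)
    fun i hi him => h0 i hi (by omega)
  obtain ⟨b1, b2⟩ := lastSign_eq_of_zero_between (α := twist α) (show k ≤ m by omega)
    fun i hi him => twist_eq_zero.2 (h0 i hi (by omega))
  rw [lastSign_of_ne_zero hk] at a1
  have h3 : signChanges α (m + 1) = signChanges α m +
    if α (m + 1) ≠ 0 ∧ α (m + 1) = -lastSign α m then 1 else 0 := rfl
  have h4 : signChanges (twist α) (m + 1) = signChanges (twist α) m +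
    if twist α (m + 1) ≠ 0 ∧ twist α (m + 1) = -lastSign (twist α) m then 1 else 0 := rfl
  rw [a2] at h3
  rw [b2] at h4
  -- With opposite signs the passage yields at most two changes, so `l - k ≤ 2`; otherwise only the
  -- twist can change, and `l - k = 1`.
  by_cases hc : α (m + 1) = -α k
  · by_cases hm : m + 1 = k + 1
    · exact Or.inl hm
    · refine Or.inr ⟨?_, hc⟩
      split_ifs at h3 h4 <;> omega
  · rw [if_neg (fun h => hc (a1 ▸ h.2))] at h3
    left
    split_ifs at h4 <;> omega

/-! ### Order and multiplication in the tropical semifield -/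

namespace TMax

variable {Γ : Type*} [AddCommGroup Γ] [LinearOrder Γ] [IsOrderedAddMonoid Γ]

theorem of_ne_zero (g : Γ) : of g ≠ 0 := WithBot.coe_ne_bot

theorem eq_zero_or_of (a : TMax Γ) : a = 0 ∨ ∃ g, a = of g := by
  induction a using WithBot.recBotCoe with
  | bot => exact Or.inl rfl
  | coe g => exact Or.inr ⟨g, rfl⟩

theorem of_lt_of {g h : Γ} : of g < of h ↔ g < h := WithBot.coe_lt_coe

theorem of_inj {g h : Γ} : of g = of h ↔ g = h := WithBot.coe_inj

theorem of_mul_of (g h : Γ) : of g * of h = of (g + h) := rfl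

theorem zero_le (a : TMax Γ) : 0 ≤ a := bot_le (α := WithBot Γ)

theorem zero_lt_of (g : Γ) : 0 < of g := WithBot.bot_lt_coe g

theorem add_eq_max (a b : TMax Γ) : a + b = max a b := rfl

theorem mul_ne_zero {a b : TMax Γ} (ha : a ≠ 0) (hb : b ≠ 0) : a * b ≠ 0 := by
  rcases eq_zero_or_of a with rfl | ⟨g, rfl⟩
  · exact absurd rfl ha
  rcases eq_zero_or_of b with rfl | ⟨h, rfl⟩
  · exact absurd rfl hb
  exact of_ne_zero _

theorem pow_ne_zero {a : TMax Γ} (ha : a ≠ 0) (n : ℕ) : a ^ n ≠ 0 := by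
  induction n with
  | zero => rw [pow_zero]; exact of_ne_zero _
  | succ n ih => rw [pow_succ]; exact mul_ne_zero ih ha

theorem mul_lt_mul_right {a b c : TMax Γ} (hc : c ≠ 0) (h : a < b) : a * c < b * c := by
  rcases eq_zero_or_of c with rfl | ⟨k, rfl⟩
  · exact absurd rfl hc
  rcases eq_zero_or_of b with rfl | ⟨g, rfl⟩
  · exact absurd h (not_lt.2 (zero_le a))
  rcases eq_zero_or_of a with rfl | ⟨g', rfl⟩
  · rw [zero_mul, of_mul_of]; exact zero_lt_of _
  rw [of_mul_of, of_mul_of, of_lt_of]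
  exact add_lt_add_left (of_lt_of.1 h) k

theorem mul_lt_mul_left {a b c : TMax Γ} (hc : c ≠ 0) (h : a < b) : c * a < c * b := by
  rw [mul_comm c, mul_comm c]; exact mul_lt_mul_right hc h

theorem mul_le_mul_right {a b : TMax Γ} (c : TMax Γ) (h : a ≤ b) : a * c ≤ b * c := by
  rcases eq_or_ne c 0 with rfl | hc
  · rw [mul_zero, mul_zero]
  rcases h.eq_or_lt with rfl | h
  · exact le_rfl
  · exact (mul_lt_mul_right hc h).le

theorem mul_le_mul_left {a b : TMax Γ} (c : TMax Γ) (h : a ≤ b) : c * a ≤ c * b := by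
  rw [mul_comm c, mul_comm c]; exact mul_le_mul_right c h

theorem mul_right_inj {a b c : TMax Γ} (hc : c ≠ 0) : c * a = c * b ↔ a = b := by
  refine ⟨fun h => ?_, fun h => by rw [h]⟩
  rcases lt_trichotomy a b with h1 | h1 | h1
  · exact absurd h (mul_lt_mul_left hc h1).ne
  · exact h1
  · exact absurd h (mul_lt_mul_left hc h1).ne'

theorem inv_mul_cancel {a : TMax Γ} (ha : a ≠ 0) : a⁻¹ * a = 1 := by
  rcases eq_zero_or_of a with rfl | ⟨g, rfl⟩
  · exact absurd rfl ha
  · change of (-g) * of g = of 0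
    rw [of_mul_of, neg_add_cancel]

theorem le_sum {ι : Type*} (s : Finset ι) (f : ι → TMax Γ) {i : ι} (hi : i ∈ s) :
    f i ≤ ∑ j ∈ s, f j := by
  classical
  rw [← Finset.add_sum_erase s f hi, add_eq_max]
  exact le_max_left _ _

theorem sum_le {ι : Type*} (s : Finset ι) (f : ι → TMax Γ) {M : TMax Γ} (h : ∀ i ∈ s, f i ≤ M) :
    ∑ j ∈ s, f j ≤ M :=
  Finset.sum_induction f (· ≤ M) (fun _ _ ha hb => max_le ha hb) (zero_le M) h

end TMax

/-! ### Modulus, sign and balance in the symmetrized tropical semiring -/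

namespace SMax

variable {Γ : Type*} [AddCommGroup Γ] [LinearOrder Γ] [IsOrderedAddMonoid Γ]

theorem modulus_zero : modulus (0 : SMax Γ) = 0 := rfl

theorem modulus_elt (s : BSign) (g : Γ) : modulus (elt s g) = TMax.of g := rfl

theorem modulus_eq_zero {a : SMax Γ} : modulus a = 0 ↔ a = 0 := by
  rcases a with _ | ⟨s, g⟩
  · exact ⟨fun _ => rfl, fun _ => rfl⟩
  · exact ⟨fun h => absurd h (TMax.of_ne_zero g), fun h => absurd h (elt_ne_zero s g)⟩

theorem modulus_opp (a : SMax Γ) : modulus a.opp = modulus a := by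
  rcases a with _ | ⟨s, g⟩ <;> rfl

theorem opp_mul (a b : SMax Γ) : (a * b).opp = a.opp * b := (system Γ).neg_mul a b

theorem mul_opp (a b : SMax Γ) : a * b.opp = (a * b).opp := by
  rw [mul_comm, ← opp_mul, mul_comm]

theorem opp_ne_zero {a : SMax Γ} (h : a ≠ 0) : a.opp ≠ 0 := by
  rw [ne_eq, ← modulus_eq_zero, modulus_opp]; exact modulus_eq_zero.not.2 h

theorem modulus_ofTMax (c : TMax Γ) : modulus (ofTMax c) = c := by
  rcases TMax.eq_zero_or_of c with rfl | ⟨g, rfl⟩ <;> rfl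

theorem isSigned_zero : (0 : SMax Γ).IsSigned := Or.inl trivial

theorem IsSigned.opp {a : SMax Γ} (h : a.IsSigned) : a.opp.IsSigned := by
  rcases a with _ | ⟨s, g⟩
  · exact h
  · rcases h with h | h <;> cases h
    exacts [Or.inr rfl, Or.inl rfl]

theorem IsSigned.mul {a b : SMax Γ} (ha : a.IsSigned) (hb : b.IsSigned) : (a * b).IsSigned := by
  rcases a with _ | ⟨s, g⟩
  · exact Or.inl trivial
  rcases b with _ | ⟨t, h⟩
  · exact Or.inl trivial
  rcases ha with ha | ha <;> rcases hb with hb | hb <;> cases ha <;> cases hb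
  exacts [Or.inl rfl, Or.inr rfl, Or.inr rfl, Or.inl rfl]

theorem IsSigned.pow {a : SMax Γ} (ha : a.IsSigned) (n : ℕ) : (a ^ n).IsSigned := by
  induction n with
  | zero => rw [pow_zero]; exact Or.inl rfl
  | succ n ih => rw [pow_succ]; exact ih.mul ha

theorem mem_vee {a : SMax Γ} : a ∈ (system Γ).vee ↔ a.IsSigned := by
  refine ⟨?_, fun h => ?_⟩
  · rintro (rfl | h)
    exacts [Or.inl trivial, h.1]
  · rcases eq_or_ne a 0 with h0 | h0
    exacts [Or.inl h0, Or.inr ⟨h, h0⟩]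

theorem zero_surpass_iff {a : SMax Γ} : (system Γ).surpass 0 a ↔ a.IsBalanced := by
  constructor
  · rintro ⟨c, hc, h⟩
    rw [zero_add] at h
    rwa [h]
  · exact fun h => ⟨a, h, (zero_add a).symm⟩

theorem balance_iff {a b : SMax Γ} : (system Γ).Balance a b ↔ (a + b.opp).IsBalanced :=
  zero_surpass_iff

theorem isBalanced_and_isSigned {a : SMax Γ} (h : a.IsBalanced) (h' : a.IsSigned) : a = 0 := by
  rcases a with _ | ⟨s, g⟩
  · rfl
  · cases h; rcases h' with h' | h' <;> cases h'

theorem eq_of_balance {a b : SMax Γ} (ha : a.IsSigned) (hb : b.IsSigned)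
    (h : (system Γ).Balance a b) : a = b :=
  eq_of_isBalanced_add_opp ha hb (balance_iff.1 h)

theorem balance_of_surpass {a b : SMax Γ} (h : (system Γ).surpass a b) :
    (system Γ).Balance a b := by
  obtain ⟨c, hc, rfl⟩ := h
  rw [balance_iff, SMax.opp_add, ← add_assoc]
  refine isBalanced_add (isBalanced_add_opp a) ?_
  rcases c with _ | ⟨s, g⟩
  · trivial
  · cases hc; rfl

theorem balance_mul_right {a b : SMax Γ} (h : (system Γ).Balance a b) (c : SMax Γ) :
    (system Γ).Balance (a * c) (b * c) := by
  rw [balance_iff] at h ⊢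
  rw [opp_mul, ← add_mul]
  exact isBalanced_mul h

/-- The sign of an element (zero for balanced elements). -/
def sgn : SMax Γ → SignType
  | zero => 0
  | elt BSign.pos _ => 1
  | elt BSign.neg _ => -1
  | elt BSign.bal _ => 0

theorem sgn_mul (a b : SMax Γ) : sgn (a * b) = sgn a * sgn b := by
  rcases a with _ | ⟨_ | _ | _, g⟩ <;> rcases b with _ | ⟨_ | _ | _, h⟩ <;> rfl

theorem sgn_opp (a : SMax Γ) : sgn a.opp = -sgn a := by
  rcases a with _ | ⟨_ | _ | _, g⟩ <;> rfl

theorem sgn_ne_zero {a : SMax Γ} (ha : a.IsSigned) (h0 : a ≠ 0) : sgn a ≠ 0 := by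
  rcases a with _ | ⟨s, g⟩
  · exact absurd rfl h0
  · rcases ha with ha | ha <;> cases ha <;> simp [sgn]

theorem eq_of_modulus_eq_of_sgn_eq {a b : SMax Γ} (ha : a.IsSigned) (hb : b.IsSigned)
    (h : modulus a = modulus b) (hs : sgn a = sgn b) : a = b := by
  rcases a with _ | ⟨s, g⟩
  · exact (modulus_eq_zero.1 h.symm).symm
  rcases b with _ | ⟨t, k⟩
  · exact modulus_eq_zero.1 h
  rw [modulus_elt, modulus_elt, TMax.of_inj] at h
  subst h
  rcases ha with ha | ha <;> rcases hb with hb | hb <;> cases ha <;> cases hb <;>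
    first | rfl | exact absurd hs (by simp only [sgn]; decide)

theorem eq_or_eq_opp_of_modulus_eq {a b : SMax Γ} (ha : a.IsSigned) (hb : b.IsSigned)
    (h : modulus a = modulus b) : a = b ∨ a = b.opp := by
  rcases eq_or_ne b 0 with rfl | h0
  · exact Or.inl (modulus_eq_zero.1 h)
  have h0' : a ≠ 0 := fun h' => h0 (modulus_eq_zero.1 (h ▸ modulus_eq_zero.2 h'))
  have : sgn a = sgn b ∨ sgn a = -sgn b := by
    have h1 := sgn_ne_zero ha h0'
    have h2 := sgn_ne_zero hb h0
    revert h1 h2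
    generalize sgn a = s, sgn b = t
    revert s t
    decide
  rcases this with h1 | h1
  · exact Or.inl (eq_of_modulus_eq_of_sgn_eq ha hb h h1)
  · exact Or.inr (eq_of_modulus_eq_of_sgn_eq ha hb.opp (by rw [modulus_opp, h])
      (by rw [sgn_opp, h1]))

/-- The sign of `a` if its modulus is `M`, and zero otherwise. -/
def topSign (M : TMax Γ) (a : SMax Γ) : SignType := if modulus a = M then sgn a else 0

theorem topSign_ne_zero {M : TMax Γ} (hM : M ≠ 0) {a : SMax Γ} (ha : a.IsSigned) :
    topSign M a ≠ 0 ↔ modulus a = M := by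
  unfold topSign
  split_ifs with h
  · exact iff_of_true (sgn_ne_zero ha fun h0 => hM (h ▸ modulus_eq_zero.2 h0)) h
  · exact iff_of_false (fun h => h rfl) h

theorem topSign_mul {M : TMax Γ} {c : SMax Γ} (hc : c ≠ 0) (a : SMax Γ) :
    topSign (modulus c * M) (c * a) = sgn c * topSign M a := by
  unfold topSign
  simp only [map_mul, TMax.mul_right_inj (modulus_eq_zero.not.2 hc), sgn_mul]
  split_ifs <;> simp

theorem topSign_opp (M : TMax Γ) (a : SMax Γ) : topSign M a.opp = -topSign M a := by
  unfold topSign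
  rw [modulus_opp, sgn_opp]
  split_ifs <;> rfl

theorem topSign_of_lt {N : TMax Γ} {a : SMax Γ} (h : modulus a < N) : topSign N a = 0 :=
  if_neg h.ne

theorem add_eq_left_of_modulus_lt {a b : SMax Γ} (h : modulus b < modulus a) : a + b = a := by
  rcases b with _ | ⟨t, k⟩
  · exact SMax.add_zero a
  rcases a with _ | ⟨s, g⟩
  · exact absurd h (not_lt.2 (TMax.zero_le _))
  exact elt_add_elt_of_gt s t (TMax.of_lt_of.1 h)

theorem add_self {a : SMax Γ} : a + a = a := by
  rcases a with _ | ⟨s, g⟩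
  · rfl
  · rw [elt_add_elt_self, BSign.add, if_pos rfl]

theorem modulus_le_of_isBalanced_add {a b : SMax Γ} (ha : a.IsSigned)
    (h : (a + b).IsBalanced) : modulus a ≤ modulus b := by
  by_contra! h1
  rw [add_eq_left_of_modulus_lt h1] at h
  rw [isBalanced_and_isSigned h ha] at h1
  exact absurd h1 (not_lt.2 (TMax.zero_le _))

/-- Truncation at an upper bound `N` of the moduli turns a balance in `S_max` into a relation
between signs. If `|b| ≠ |b'|`, or if `b = ⊖ b'`, then `b ⊖ b'` is signed and `a` equals it. If `b =
b'`, the difference is balanced and only bounds `|a|`. -/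
theorem signBal_of_balance {N : TMax Γ} {a b b' : SMax Γ} (ha : a.IsSigned)
    (hb : b.IsSigned) (hb' : b'.IsSigned) (hbN : modulus b ≤ N) (hbN' : modulus b' ≤ N)
    (h : (system Γ).Balance a (b + b'.opp)) :
    modulus a ≤ N ∧ SignBal (topSign N a) (topSign N b) (topSign N b') := by
  rcases lt_trichotomy (modulus b) (modulus b') with h1 | h1 | h1
  · rw [add_comm, add_eq_left_of_modulus_lt (by rwa [modulus_opp])] at h
    obtain rfl := eq_of_balance ha hb'.opp h
    rw [modulus_opp, topSign_opp, topSign_of_lt (h1.trans_le hbN')]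
    refine ⟨hbN', ?_⟩
    generalize topSign N b' = s
    revert s
    decide
  · rcases eq_or_eq_opp_of_modulus_eq hb hb' h1 with rfl | rfl
    · rw [balance_iff] at h
      have h2 := modulus_le_of_isBalanced_add ha h
      rw [modulus_opp, map_add, modulus_opp, TMax.add_eq_max, max_self] at h2
      refine ⟨h2.trans hbN, ?_⟩
      rw [SignBal, if_pos rfl]
      rcases hbN.eq_or_lt with h3 | h3
      -- At level zero the truncated sign carries no information, but then `a = 0`.
      · rcases eq_or_ne N 0 with rfl | hN
        · rw [h3] at h2
          have := le_antisymm h2 (TMax.zero_le _)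
          rw [modulus_eq_zero] at this
          rw [this]
          exact fun _ => ite_self _
        · exact fun h4 => absurd h4 ((topSign_ne_zero hN hb).2 h3)
      · exact fun _ => topSign_of_lt (h2.trans_lt h3)
    · rw [add_self] at h
      obtain rfl := eq_of_balance ha hb h
      refine ⟨hbN, ?_⟩
      rw [topSign_opp]
      generalize topSign N b' = s
      revert s
      decide
  · rw [add_eq_left_of_modulus_lt (by rwa [modulus_opp])] at h
    obtain rfl := eq_of_balance ha hb h
    rw [topSign_of_lt (h1.trans_le hbN)]
    refine ⟨hbN, ?_⟩
    generalize topSign N a = s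
    revert s
    decide

end SMax

/-! ### Descartes' bound for the multiplicity in the symmetrized tropical semiring -/

namespace SMax

variable {Γ : Type*} [AddCommGroup Γ] [LinearOrder Γ] [IsOrderedAddMonoid Γ]

/-- The signs of the monomials of `P` of modulus `M` at `r`; the other ones are ignored. -/
def signSeq (M : TMax Γ) (r : SMax Γ) (P : (SMax Γ)[X]) (i : ℕ) : SignType :=
  topSign M (P.coeff i * r ^ i)

/-- `M` is the largest modulus of the monomials of `P` at `r`. -/
def IsLevel (M : TMax Γ) (r : SMax Γ) (P : (SMax Γ)[X]) : Prop :=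
  (∀ i, modulus (P.coeff i * r ^ i) ≤ M) ∧ ∃ i, modulus (P.coeff i * r ^ i) = M

theorem exists_isLevel {r : SMax Γ} (hr : r ≠ 0) {P : (SMax Γ)[X]} (hP : P ≠ 0) :
    ∃ M, M ≠ 0 ∧ IsLevel M r P := by
  obtain ⟨i, hi, h⟩ := Finset.exists_max_image P.support
    (fun i => modulus (P.coeff i * r ^ i)) (support_nonempty.2 hP)
  refine ⟨modulus (P.coeff i * r ^ i), ?_, fun j => ?_, i, rfl⟩
  · rw [map_mul, map_pow]
    exact TMax.mul_ne_zero (modulus_eq_zero.not.2 (mem_support_iff.1 hi))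
      (TMax.pow_ne_zero (modulus_eq_zero.not.2 hr) i)
  · by_cases hj : j ∈ P.support
    · exact h j hj
    · rw [notMem_support_iff.1 hj, zero_mul]
      exact TMax.zero_le _

/-- The modulus is a semiring morphism: terms of opposite signs sum to a balanced element of the
same modulus, so no cancellation lowers it. -/
theorem IsLevel.modulus_eval {M : TMax Γ} {r : SMax Γ} {P : (SMax Γ)[X]} (h : IsLevel M r P)
    (hM : M ≠ 0) : modulus (P.eval r) = M := by
  rw [eval_eq_sum_range, map_sum]
  refine le_antisymm (TMax.sum_le _ _ fun i _ => h.1 i) ?_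
  obtain ⟨i, hi⟩ := h.2
  rw [← hi]
  refine TMax.le_sum _ (fun i => modulus (P.coeff i * r ^ i)) (Finset.mem_range_succ_iff.2 ?_)
  by_contra! hlt
  rw [coeff_eq_zero_of_natDegree_lt hlt, zero_mul, modulus_zero] at hi
  exact hM hi.symm

/-- If all dominant monomials had the sign `s`, their sum would be signed and nonzero, whereas the
value at a root is balanced. Used for both signs, this gives the first sign change. -/
theorem exists_signSeq_eq_neg {M : TMax Γ} (hM : M ≠ 0) {r : SMax Γ} (hr : r.IsSigned)
    {P : (SMax Γ)[X]} (hP : (system Γ).IsVeePoly P) (h : IsLevel M r P)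
    (hroot : (system Γ).IsRoot r P) (s : SignType) (hs : s ≠ 0) : ∃ i, signSeq M r P i = -s := by
  by_contra! hne
  -- This alternative is stable under addition, hence passes from the monomials to the whole sum.
  have key : modulus (P.eval r) < M ∨
      (modulus (P.eval r) = M ∧ (P.eval r).IsSigned ∧ sgn (P.eval r) = s) := by
    rw [eval_eq_sum_range]
    refine Finset.sum_induction _
      (fun x => modulus x < M ∨ (modulus x = M ∧ x.IsSigned ∧ sgn x = s)) ?_ ?_ ?_
    · rintro a b (ha | ha) (hb | hb)
      · left
        rw [map_add, TMax.add_eq_max]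
        exact max_lt ha hb
      · right
        rwa [add_comm, add_eq_left_of_modulus_lt (by rwa [hb.1])]
      · right
        rwa [add_eq_left_of_modulus_lt (by rwa [ha.1])]
      · right
        obtain rfl := eq_of_modulus_eq_of_sgn_eq ha.2.1 hb.2.1 (ha.1.trans hb.1.symm)
          (ha.2.2.trans hb.2.2.symm)
        rwa [add_self]
    · left
      exact lt_of_le_of_ne (TMax.zero_le M) hM.symm
    · intro i _
      rcases (h.1 i).lt_or_eq with h1 | h1
      · exact Or.inl h1
      · have hsg : (P.coeff i * r ^ i).IsSigned := (mem_vee.1 (hP i)).mul (hr.pow i)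
        refine Or.inr ⟨h1, hsg, ?_⟩
        have h2 := (topSign_ne_zero hM hsg).2 h1
        have h3 := hne i
        have h4 : signSeq M r P i = sgn (P.coeff i * r ^ i) := if_pos h1
        rw [← h4]
        change signSeq M r P i ≠ 0 at h2
        have key : ∀ s t : SignType, s ≠ 0 → t ≠ 0 → t ≠ -s → t = s := by decide
        exact key _ _ hs h2 h3
  have hev := h.modulus_eval hM
  rcases key with h1 | h1
  · exact h1.ne hev
  · rw [isBalanced_and_isSigned (zero_surpass_iff.1 hroot) h1.2.1, modulus_zero] at hev
    exact hM hev.symm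

theorem coeff_X_add_C_mul_zero (a : SMax Γ) (Q : (SMax Γ)[X]) :
    ((X + C a) * Q).coeff 0 = a * Q.coeff 0 := by
  rw [add_mul, coeff_add, coeff_X_mul_zero, coeff_C_mul, zero_add]

theorem coeff_X_add_C_mul_succ (a : SMax Γ) (Q : (SMax Γ)[X]) (i : ℕ) :
    ((X + C a) * Q).coeff (i + 1) = Q.coeff i + a * Q.coeff (i + 1) := by
  rw [add_mul, coeff_add, coeff_X_mul, coeff_C_mul]

theorem ne_zero_of_isQuotient {r : SMax Γ} {P Q : (SMax Γ)[X]} (hP : (system Γ).IsVeePoly P)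
    (h : (system Γ).IsQuotient r P Q) (hP0 : P ≠ 0) : Q ≠ 0 := by
  rintro rfl
  obtain ⟨-, l, hl, hbal⟩ := h
  refine hP0 (Polynomial.ext fun i => ?_)
  have h1 := hbal i
  rw [mul_zero, coeff_zero, coeff_C_mul] at h1
  have h2 := eq_of_balance (hl.1.mul (mem_vee.1 (hP i))) isSigned_zero h1
  exact (system Γ).cancel l hl _ _ (h2.trans (mul_zero l).symm)

/-- Rescaling the unknown by `r` turns the divisor `Y ⊖ r` into `Y ⊖ 1` up to a factor; truncating
the rescaled coefficients at their top modulus then reduces the claim to sign sequences. -/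
theorem exists_signChanges_succ_le {M : TMax Γ} (hM : M ≠ 0) {r : SMax Γ} (hr : r.IsSigned)
    (hr0 : r ≠ 0) {P Q : (SMax Γ)[X]} (hP : (system Γ).IsVeePoly P) (hPM : IsLevel M r P)
    (h : (system Γ).IsQuotient r P Q) :
    ∃ N, N ≠ 0 ∧ IsLevel N r Q ∧
      ∀ n, ∃ m, signChanges (signSeq N r Q) n + 1 ≤ signChanges (signSeq M r P) m := by
  have hP0 : P ≠ 0 := by
    rintro rfl
    obtain ⟨i, hi⟩ := hPM.2
    rw [coeff_zero, zero_mul, modulus_zero] at hi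
    exact hM hi.symm
  obtain ⟨N, hN, hQN⟩ := exists_isLevel hr0 (ne_zero_of_isQuotient hP h hP0)
  refine ⟨N, hN, hQN, ?_⟩
  obtain ⟨hQ, l, hl, hbal⟩ := h
  -- With these rescaled coefficients the quotient relation reads `a (i + 1) ∇ b i ⊖ b (i + 1)` and
  -- `a 0 ∇ ⊖ b 0`.
  set a : ℕ → SMax Γ := fun i => l * (P.coeff i * r ^ i) with ha_def
  set b : ℕ → SMax Γ := fun i => r * (Q.coeff i * r ^ i) with hb_def
  have ha : ∀ i, (a i).IsSigned := fun i => hl.1.mul ((mem_vee.1 (hP i)).mul (hr.pow i))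
  have hb : ∀ i, (b i).IsSigned := fun i => hr.mul ((mem_vee.1 (hQ i)).mul (hr.pow i))
  have hbN : ∀ i, modulus (b i) ≤ modulus r * N := fun i => by
    rw [hb_def, map_mul]; exact TMax.mul_le_mul_left _ (hQN.1 i)
  have hneg : ∀ x : SMax Γ, (system Γ).neg x = x.opp := fun _ => rfl
  have B0 : (system Γ).Balance (a 0) (0 + (b 0).opp) := by
    have h1 := hbal 0
    rw [coeff_C_mul, coeff_X_add_C_mul_zero, hneg, ← opp_mul] at h1
    simpa [ha_def, hb_def] using h1
  have B1 : ∀ i, (system Γ).Balance (a (i + 1)) (b i + (b (i + 1)).opp) := fun i => by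
    have h1 := balance_mul_right (hbal (i + 1)) (r ^ (i + 1))
    rw [coeff_C_mul, coeff_X_add_C_mul_succ, hneg, ← opp_mul, add_mul, ← opp_mul] at h1
    rwa [show a (i + 1) = l * P.coeff (i + 1) * r ^ (i + 1) by simp only [ha_def]; ring,
      show b i = Q.coeff i * r ^ (i + 1) by simp only [hb_def]; ring,
      show b (i + 1) = r * Q.coeff (i + 1) * r ^ (i + 1) by simp only [hb_def]; ring]
  have hz : (0 : SMax Γ).IsSigned := isSigned_zero
  have S0 := signBal_of_balance (ha 0) hz (hb 0) (TMax.zero_le (modulus r * N)) (hbN 0) B0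
  have S1 := fun i => signBal_of_balance (ha (i + 1)) (hb i) (hb (i + 1)) (hbN i) (hbN (i + 1))
    (B1 i)
  have hrm : modulus r ≠ 0 := modulus_eq_zero.not.2 hr0
  have hrN : modulus r * N ≠ 0 := TMax.mul_ne_zero hrm hN
  rw [topSign_of_lt (a := 0) (lt_of_le_of_ne (TMax.zero_le _) hrN.symm)] at S0
  have haN : ∀ i, modulus (a i) ≤ modulus r * N := by
    rintro (_ | i)
    exacts [S0.1, (S1 i).1]
  obtain ⟨i₀, hi₀⟩ := hQN.2
  have hβ : topSign (modulus r * N) (b i₀) ≠ 0 :=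
    (topSign_ne_zero hrN (hb i₀)).2 (by rw [hb_def, map_mul, hi₀])
  have bound : ∀ n, ∃ m, signChanges (signSeq N r Q) n + 1 ≤
      signChanges (fun i => topSign (modulus r * N) (a i)) m := fun n => by
    have h1 := signChanges_succ_le (α := fun i => topSign (modulus r * N) (a i))
      (β := fun i => topSign (modulus r * N) (b i)) S0.2 (fun i => (S1 i).2)
      -- The index must lie beyond `i₀`, where `b` reaches the top modulus, and beyond the degree of
      -- `Q`, where `b` vanishes.
      (i := i₀) (n := max n (max i₀ (Q.natDegree + 1)))
      ((le_max_left _ _).trans (le_max_right _ _)) hβ (by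
        have : Q.natDegree < max n (max i₀ (Q.natDegree + 1)) := by
          simp only [lt_max_iff]; omega
        simp only [hb_def]
        rw [coeff_eq_zero_of_natDegree_lt this, zero_mul, mul_zero]
        exact ite_self _)
    have h2 : (fun i => topSign (modulus r * N) (b i)) =
        fun i => sgn r * signSeq N r Q i := funext fun i => topSign_mul hr0 _
    rw [h2, signChanges_mul _ (sgn_ne_zero hr hr0)] at h1
    exact ⟨_, (Nat.succ_le_succ (signChanges_mono _ (le_max_left n _))).trans h1⟩
  -- The levels of the two sides agree: were `a` everywhere below `|r| N`, its truncated signs would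
  -- all vanish, contradicting the sign change that `bound` provides.
  have hlM : modulus l * M = modulus r * N := by
    obtain ⟨i, hi⟩ := hPM.2
    refine le_antisymm ?_ ?_
    · have := haN i
      rwa [ha_def, map_mul, hi] at this
    · by_contra! hlt
      obtain ⟨m, hm⟩ := bound 0
      have h0 : (fun i => topSign (modulus r * N) (a i)) = fun _ => 0 := funext fun i => by
        refine topSign_of_lt (lt_of_le_of_lt ?_ hlt)
        rw [ha_def, map_mul]
        exact TMax.mul_le_mul_left _ (hPM.1 i)
      rw [h0, signChanges_eq_zero_of_zero_before fun _ _ => rfl] at hm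
      omega
  have h3 : (fun i => topSign (modulus r * N) (a i)) = fun i => sgn l * signSeq M r P i :=
    funext fun i => by rw [← hlM]; exact topSign_mul hl.2 _
  intro n
  obtain ⟨m, hm⟩ := bound n
  rw [h3, signChanges_mul _ (sgn_ne_zero hl.1 hl.2)] at hm
  exact ⟨m, hm⟩

/-- Descartes' rule of signs: the multiplicity of a nonzero root is at most the number of sign
changes of the monomials of largest modulus. -/
theorem exists_le_signChanges_of_multGE {r : SMax Γ} (hr : r.IsSigned) (hr0 : r ≠ 0) (k : ℕ) :
    ∀ {P : (SMax Γ)[X]} {M : TMax Γ}, M ≠ 0 → (system Γ).IsVeePoly P → IsLevel M r P →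
      (system Γ).MultGE r k P → ∃ n, k ≤ signChanges (signSeq M r P) n := by
  induction k using Nat.twoStepInduction with
  | zero => exact fun _ _ _ _ => ⟨0, Nat.zero_le _⟩
  | one =>
    intro P M hM hP hPM hroot
    obtain ⟨i, hi⟩ := exists_signSeq_eq_neg hM hr hP hPM hroot (-1) (by decide)
    obtain ⟨j, hj⟩ := exists_signSeq_eq_neg hM hr hP hPM hroot 1 (by decide)
    exact exists_one_le_signChanges (hi.trans (by decide)) hj
  | more k _ ih =>
    rintro P M hM hP hPM ⟨-, Q, hQ, hmult⟩
    obtain ⟨N, hN, hQN, h⟩ := exists_signChanges_succ_le hM hr hr0 hP hPM hQ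
    obtain ⟨n, hn⟩ := ih hN hQ.1 hQN hmult
    obtain ⟨m, hm⟩ := h n
    exact ⟨m, by omega⟩

/-- Here `Y ⊖ 0` is `Y`, so a quotient shifts the coefficients by one index, up to a tangible
factor; being a root means that the constant term vanishes, since a signed balanced element is zero.
-/
theorem coeff_eq_zero_of_multGE_zero (k : ℕ) : ∀ {P : (SMax Γ)[X]}, (system Γ).IsVeePoly P →
    (system Γ).MultGE 0 k P → ∀ i < k, P.coeff i = 0 := by
  have hroot : ∀ {P : (SMax Γ)[X]}, (system Γ).IsVeePoly P → (system Γ).IsRoot 0 P →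
      P.coeff 0 = 0 := fun {P} hP h => by
    rw [coeff_zero_eq_eval_zero]
    refine isBalanced_and_isSigned (zero_surpass_iff.1 h) ?_
    rw [← coeff_zero_eq_eval_zero]
    exact mem_vee.1 (hP 0)
  induction k using Nat.twoStepInduction with
  | zero => intro P _ _ i hi; omega
  | one =>
    intro P hP h i hi
    rw [Nat.lt_one_iff.1 hi]
    exact hroot hP h
  | more k _ ih =>
    rintro P hP ⟨h0, Q, ⟨hQ, l, hl, hbal⟩, hmult⟩ (_ | i) hi
    · exact hroot hP h0
    have h1 := hbal (i + 1)
    have h2 : (system Γ).neg 0 = 0 := rfl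
    rw [h2, C_0, add_zero, coeff_C_mul, coeff_X_mul, ih hQ hmult i (by omega)] at h1
    have h3 := eq_of_balance (hl.1.mul (mem_vee.1 (hP _))) isSigned_zero h1
    exact (system Γ).cancel l hl _ _ (h3.trans (mul_zero l).symm)

end SMax

theorem coeff_coeffMap {R S : Type*} [Semiring R] [Semiring S] {f : R → S} (hf : f 0 = 0)
    (P : R[X]) (i : ℕ) : (coeffMap f P).coeff i = f (P.coeff i) := by
  rw [coeffMap, finsetSum_coeff]
  simp only [coeff_monomial, Finset.sum_ite_eq', Finset.mem_range]
  split_ifs with h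
  · rfl
  · rw [coeff_eq_zero_of_natDegree_lt (by omega), hf]

/-! ### Newton polygons -/

namespace TMax

variable {Γ : Type*} [AddCommGroup Γ] [LinearOrder Γ] [IsOrderedAddMonoid Γ]

/-- `M` is the maximum of `w`, and `F` and `E` are the first and last indices where it is
attained. -/
structure IsEdge (w : ℕ → TMax Γ) (M : TMax Γ) (F E : ℕ) : Prop where
  ne_zero : M ≠ 0
  eq_first : w F = M
  eq_last : w E = M
  le : ∀ i, w i ≤ M
  lt_of_lt : ∀ i < F, w i < M
  lt_of_gt : ∀ i, E < i → w i < M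

variable {w w' : ℕ → TMax Γ} {M a b : TMax Γ} {F E : ℕ}

/-- The weights of a product by `Y - x`, where `a` is the weight of `Y` and `b` that of `x`. -/
structure IsLinearProduct (a b : TMax Γ) (w w' : ℕ → TMax Γ) : Prop where
  zero : w' 0 = b * w 0
  le : ∀ i, w' (i + 1) ≤ max (a * w i) (b * w (i + 1))
  eq_left : ∀ i, b * w (i + 1) < a * w i → w' (i + 1) = a * w i
  eq_right : ∀ i, a * w i < b * w (i + 1) → w' (i + 1) = b * w (i + 1)

theorem mul_lt_mul_of_le_of_lt {x y M N : TMax Γ} (hM : M ≠ 0) (h1 : x ≤ M) (h2 : y < N) :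
    y * x < N * M :=
  (mul_le_mul_left y h1).trans_lt (mul_lt_mul_right hM h2)

/-- The term `Y` dominates the factor `Y - x`, so the edge is only translated by one index. -/
theorem IsEdge.mul_of_lt (h : IsEdge w M F E) (hw : IsLinearProduct a b w w') (hab : b < a) :
    IsEdge w' (a * M) (F + 1) (E + 1) := by
  have ha : a ≠ 0 := fun h0 => absurd hab (not_lt.2 (h0 ▸ zero_le b))
  have hb : ∀ i, b * w i < a * M := fun i => mul_lt_mul_of_le_of_lt h.ne_zero (h.le i) hab
  refine ⟨mul_ne_zero ha h.ne_zero, ?_, ?_, ?_, ?_, ?_⟩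
  · rw [hw.eq_left F (by rw [h.eq_first]; exact hb _), h.eq_first]
  · rw [hw.eq_left E (by rw [h.eq_last]; exact hb _), h.eq_last]
  · rintro (_ | i)
    · rw [hw.zero]; exact (hb 0).le
    · exact (hw.le i).trans (max_le (mul_le_mul_left a (h.le i)) (hb _).le)
  · rintro (_ | i) hi
    · rw [hw.zero]; exact hb 0
    · exact (hw.le i).trans_lt
        (max_lt (mul_lt_mul_left ha (h.lt_of_lt i (by omega))) (hb _))
  · rintro (_ | i) hi
    · omega
    · exact (hw.le i).trans_lt
        (max_lt (mul_lt_mul_left ha (h.lt_of_gt i (by omega))) (hb _))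

/-- The constant dominates the factor, so the edge does not move. -/
theorem IsEdge.mul_of_gt (h : IsEdge w M F E) (hw : IsLinearProduct a b w w') (hab : a < b) :
    IsEdge w' (b * M) F E := by
  have hb : b ≠ 0 := fun h0 => absurd hab (not_lt.2 (h0 ▸ zero_le a))
  have ha : ∀ i, a * w i < b * M := fun i => mul_lt_mul_of_le_of_lt h.ne_zero (h.le i) hab
  have key : ∀ i, w i = M → w' i = b * M := by
    rintro (_ | i) hi
    · rw [hw.zero, hi]
    · rw [hw.eq_right i (by rw [hi]; exact ha _), hi]
  refine ⟨mul_ne_zero hb h.ne_zero, key F h.eq_first, key E h.eq_last, ?_, ?_, ?_⟩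
  · rintro (_ | i)
    · rw [hw.zero]; exact mul_le_mul_left b (h.le 0)
    · exact (hw.le i).trans (max_le (ha _).le (mul_le_mul_left b (h.le _)))
  · rintro (_ | i) hi
    · rw [hw.zero]; exact mul_lt_mul_left hb (h.lt_of_lt 0 hi)
    · exact (hw.le i).trans_lt (max_lt (ha _) (mul_lt_mul_left hb (h.lt_of_lt _ hi)))
  · rintro (_ | i) hi
    · omega
    · exact (hw.le i).trans_lt (max_lt (ha _) (mul_lt_mul_left hb (h.lt_of_gt _ hi)))

/-- Both terms weigh the same, and the edge gains one unit of length. At `F` and `E + 1` only one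
term reaches the top, so the values there are exact; in between, ties may cancel, but an upper bound
is all that is needed. -/
theorem IsEdge.mul_of_eq (h : IsEdge w M F E) (hw : IsLinearProduct a a w w') (ha : a ≠ 0) :
    IsEdge w' (a * M) F (E + 1) := by
  refine ⟨mul_ne_zero ha h.ne_zero, ?_, ?_, ?_, ?_, ?_⟩
  · have h1 := h.eq_first
    have h2 := h.lt_of_lt
    rcases F with _ | F
    · rw [hw.zero, h1]
    · rw [hw.eq_right F (by rw [h1]; exact mul_lt_mul_left ha (h2 F (by omega))), h1]
  · rw [hw.eq_left E
      (by rw [h.eq_last]; exact mul_lt_mul_left ha (h.lt_of_gt _ (by omega))), h.eq_last]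
  · rintro (_ | i)
    · rw [hw.zero]; exact mul_le_mul_left a (h.le 0)
    · exact (hw.le i).trans (max_le (mul_le_mul_left a (h.le _)) (mul_le_mul_left a (h.le _)))
  · rintro (_ | i) hi
    · rw [hw.zero]; exact mul_lt_mul_left ha (h.lt_of_lt 0 hi)
    · exact (hw.le i).trans_lt (max_lt (mul_lt_mul_left ha (h.lt_of_lt _ (by omega)))
        (mul_lt_mul_left ha (h.lt_of_lt _ hi)))
  · rintro (_ | i) hi
    · omega
    · exact (hw.le i).trans_lt (max_lt (mul_lt_mul_left ha (h.lt_of_gt _ (by omega)))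
        (mul_lt_mul_left ha (h.lt_of_gt _ (by omega))))

end TMax

/-! ### Signed valuations of a field -/

namespace SMax

variable {R Γ : Type*} [Field R] [AddCommGroup Γ] [LinearOrder Γ] [IsOrderedAddMonoid Γ]

/-- The morphisms of semiring systems from a field to `S_max`. -/
abbrev IsSignedValuation (sv : R → SMax Γ) : Prop :=
  (SemiringSystem.ofField R).IsMorphism (system Γ) sv

variable {sv : R → SMax Γ}

theorem sv_isSigned (hsv : IsSignedValuation sv) (y : R) : (sv y).IsSigned := by
  rcases eq_or_ne y 0 with rfl | h
  · rw [hsv.map_zero]; exact isSigned_zero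
  · exact (hsv.map_tangible y h).1

theorem sv_eq_zero (hsv : IsSignedValuation sv) {y : R} : sv y = 0 ↔ y = 0 := by
  refine ⟨fun h => ?_, fun h => by rw [h, hsv.map_zero]⟩
  by_contra hy
  exact (hsv.map_tangible y hy).2 h

theorem sv_mul (hsv : IsSignedValuation sv) (y z : R) : sv (y * z) = sv y * sv z := by
  rcases eq_or_ne y 0 with rfl | h
  · rw [zero_mul, hsv.map_zero, zero_mul]
  · exact hsv.map_mul y h z

theorem sv_one (hsv : IsSignedValuation sv) : sv 1 = 1 := by
  have h := sv_mul hsv 1 1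
  rw [mul_one] at h
  exact ((system Γ).cancel _ (hsv.map_tangible 1 one_ne_zero) _ _
    (h.symm.trans (mul_one _).symm))

theorem sv_pow (hsv : IsSignedValuation sv) (y : R) (n : ℕ) : sv (y ^ n) = sv y ^ n := by
  induction n with
  | zero => rw [pow_zero, pow_zero, sv_one hsv]
  | succ n ih => rw [pow_succ, pow_succ, sv_mul hsv, ih]

theorem sv_neg (hsv : IsSignedValuation sv) (y : R) : sv (-y) = (sv y).opp := hsv.map_neg y

theorem sv_sub (hsv : IsSignedValuation sv) (y z : R) : Surpass (sv (y - z)) (sv y + (sv z).opp) := by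
  rw [sub_eq_add_neg, ← sv_neg hsv]
  exact hsv.map_add y (-z)

theorem sv_sum (hsv : IsSignedValuation sv) {ι : Type*} (s : Finset ι) (f : ι → R) :
    (system Γ).surpass (sv (∑ i ∈ s, f i)) (∑ i ∈ s, sv (f i)) := by
  classical
  induction s using Finset.induction_on with
  | empty => rw [Finset.sum_empty, Finset.sum_empty, hsv.map_zero]; exact (system Γ).surpass_refl 0
  | insert i s hi ih =>
    rw [Finset.sum_insert hi, Finset.sum_insert hi]
    exact (system Γ).surpass_trans _ _ _ (hsv.map_add _ _)
      ((system Γ).surpass_add _ _ _ _ ((system Γ).surpass_refl _) ih)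

theorem modulus_sv_sub_le (hsv : IsSignedValuation sv) (y z : R) :
    modulus (sv (y - z)) ≤ max (modulus (sv y)) (modulus (sv z)) := by
  obtain ⟨c, -, h⟩ := sv_sub hsv y z
  have h1 := congrArg modulus h
  rw [map_add, map_add, modulus_opp, TMax.add_eq_max, TMax.add_eq_max] at h1
  rw [h1]
  exact le_max_left _ _

theorem sv_sub_eq_left (hsv : IsSignedValuation sv) {y z : R} (h : modulus (sv z) < modulus (sv y)) :
    sv (y - z) = sv y := by
  have h1 := sv_sub hsv y z
  rw [add_eq_left_of_modulus_lt (by rwa [modulus_opp])] at h1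
  exact eq_of_surpass (sv_isSigned hsv y) h1 (sv_isSigned hsv _)

theorem modulus_sv_sub_comm (hsv : IsSignedValuation sv) (y z : R) :
    modulus (sv (y - z)) = modulus (sv (z - y)) := by
  rw [← neg_sub, sv_neg hsv, modulus_opp]

theorem isVeePoly_coeffMap (hsv : IsSignedValuation sv) (P : R[X]) : (system Γ).IsVeePoly (coeffMap sv P) :=
  fun i => by
    rw [coeff_coeffMap hsv.map_zero]
    exact mem_vee.2 (sv_isSigned hsv _)

/-- The value `P(y) = 0` has image `0`, and `sv` of a sum is surpassed by the sum of the images,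
which is the value at `sv y`. -/
theorem isRoot_coeffMap (hsv : IsSignedValuation sv) {P : R[X]} {y : R} (h : P.eval y = 0) :
    (system Γ).IsRoot (sv y) (coeffMap sv P) := by
  have h1 : (coeffMap sv P).natDegree < P.natDegree + 1 := by
    refine Nat.lt_succ_of_le (natDegree_le_iff_coeff_eq_zero.2 fun i hi => ?_)
    rw [coeff_coeffMap hsv.map_zero, coeff_eq_zero_of_natDegree_lt hi, hsv.map_zero]
  rw [SemiringSystem.IsRoot, eval_eq_sum_range' h1, ← hsv.map_zero, ← h, eval_eq_sum_range]
  simp only [coeff_coeffMap hsv.map_zero, ← sv_pow hsv, ← sv_mul hsv]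
  exact sv_sum hsv _ _

/-- Each coefficient of `(Y - y) Q` is a sum of at most two terms, so its image is surpassed by the
corresponding coefficient on the tropical side; surpassing implies balance, and `λ = 1` works. -/
theorem isQuotient_coeffMap (hsv : IsSignedValuation sv) (y : R) (Q : R[X]) :
    (system Γ).IsQuotient (sv y) (coeffMap sv ((X - C y) * Q)) (coeffMap sv Q) := by
  refine ⟨isVeePoly_coeffMap hsv Q, 1, (system Γ).tangible.one_mem, fun i => ?_⟩
  apply balance_of_surpass
  rw [C_1, one_mul, coeff_coeffMap hsv.map_zero]
  have hneg : ∀ x : SMax Γ, (system Γ).neg x = x.opp := fun _ => rfl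
  rcases i with _ | i
  · rw [coeff_X_add_C_mul_zero, coeff_coeffMap hsv.map_zero, hneg, ← sv_neg hsv, ← sv_mul hsv]
    have e : ((X - C y) * Q).coeff 0 = -y * Q.coeff 0 := by simp [sub_mul]
    rw [e]
    exact (system Γ).surpass_refl _
  · rw [coeff_X_add_C_mul_succ, coeff_coeffMap hsv.map_zero, coeff_coeffMap hsv.map_zero, hneg,
      ← sv_neg hsv, ← sv_mul hsv]
    have e : ((X - C y) * Q).coeff (i + 1) = Q.coeff i + -y * Q.coeff (i + 1) := by
      rw [sub_mul, coeff_sub, coeff_X_mul, coeff_C_mul]; ring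
    rw [e]
    exact hsv.map_add _ _

/-- The roots in `s` are split off one by one, while the cofactor `G` is carried along unchanged. -/
theorem multGE_coeffMap (hsv : IsSignedValuation sv) (r : SMax Γ) (k : ℕ) : ∀ (P G : R[X]) (s : Multiset R),
    s.card = k → (∀ y ∈ s, sv y = r) → P = (s.map fun y => X - C y).prod * G →
    (system Γ).MultGE r k (coeffMap sv P) := by
  have step : ∀ (k : ℕ) (P G : R[X]) (s : Multiset R), s.card = k + 1 → (∀ y ∈ s, sv y = r) →
      P = (s.map fun y => X - C y).prod * G → (system Γ).IsRoot r (coeffMap sv P) ∧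
      ∃ (Q : R[X]) (t : Multiset R), (system Γ).IsQuotient r (coeffMap sv P) (coeffMap sv Q) ∧
        t.card = k ∧ (∀ y ∈ t, sv y = r) ∧ Q = (t.map fun y => X - C y).prod * G := by
    intro k P G s hs hsr hP
    obtain ⟨y, hy⟩ := Multiset.card_pos_iff_exists_mem.1 (by omega : 0 < s.card)
    obtain ⟨t, rfl⟩ := Multiset.exists_cons_of_mem hy
    rw [Multiset.map_cons, Multiset.prod_cons, mul_assoc] at hP
    obtain rfl := hsr y (Multiset.mem_cons_self _ _)
    refine ⟨isRoot_coeffMap hsv (by simp [hP]), _, t, hP ▸ isQuotient_coeffMap hsv y _, ?_,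
      fun z hz => hsr z (Multiset.mem_cons_of_mem hz), rfl⟩
    simpa using hs
  induction k using Nat.twoStepInduction with
  | zero => exact fun _ _ _ _ _ _ => trivial
  | one =>
    intro P G s hs hsr hP
    exact (step 0 P G s hs hsr hP).1
  | more k _ ih =>
    intro P G s hs hsr hP
    obtain ⟨h1, Q, t, hQ, h2, h3, h4⟩ := step (k + 1) P G s hs hsr hP
    exact ⟨h1, coeffMap sv Q, hQ, ih Q G t h2 h3 h4⟩

/-- The coefficients of `(Y - y) Q` are differences, and `|sv|` satisfies the ultrametric
inequality, with equality when the moduli differ. -/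
theorem isLinearProduct_sv (hsv : IsSignedValuation sv) (c : TMax Γ) (y : R) (Q : R[X]) :
    TMax.IsLinearProduct c (modulus (sv y)) (fun i => modulus (sv (Q.coeff i)) * c ^ i)
      (fun i => modulus (sv (((X - C y) * Q).coeff i)) * c ^ i) := by
  have e0 : ((X - C y) * Q).coeff 0 = -(y * Q.coeff 0) := by simp [sub_mul]
  have e1 : ∀ i, ((X - C y) * Q).coeff (i + 1) = Q.coeff i - y * Q.coeff (i + 1) := fun i => by
    simp [sub_mul]
  have hl : ∀ i, c * (modulus (sv (Q.coeff i)) * c ^ i) =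
      modulus (sv (Q.coeff i)) * c ^ (i + 1) := fun i => by ring
  have hr : ∀ i, modulus (sv y) * (modulus (sv (Q.coeff (i + 1))) * c ^ (i + 1)) =
      modulus (sv (y * Q.coeff (i + 1))) * c ^ (i + 1) := fun i => by
    rw [sv_mul hsv, map_mul]; ring
  -- Cancelling the power of `c` by contraposition also covers `c = 0`.
  have hlt : ∀ (i : ℕ) {u v : TMax Γ}, u * c ^ (i + 1) < v * c ^ (i + 1) → u < v :=
    fun i u v h => by
      by_contra! h1
      exact absurd h (not_lt.2 (TMax.mul_le_mul_right _ h1))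
  constructor
  · rw [e0, sv_neg hsv, modulus_opp, sv_mul hsv, map_mul, mul_assoc]
  · intro i
    rw [e1, hl, hr]
    rcases le_max_iff.1 (modulus_sv_sub_le hsv (Q.coeff i) (y * Q.coeff (i + 1))) with h | h
    · exact le_max_of_le_left (TMax.mul_le_mul_right _ h)
    · exact le_max_of_le_right (TMax.mul_le_mul_right _ h)
  · intro i h
    rw [hl, hr] at h
    rw [e1, hl, sv_sub_eq_left hsv (hlt i h)]
  · intro i h
    rw [hl, hr] at h
    rw [e1, hr, modulus_sv_sub_comm hsv, sv_sub_eq_left hsv (hlt i h)]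

/-- The edge of slope `c` of the Newton polygon of a split polynomial: its length is the number of
roots of modulus `c`. -/
theorem exists_isEdge (hsv : IsSignedValuation sv) {c : TMax Γ} (hc : c ≠ 0) {a : R} (ha : a ≠ 0)
    (s : Multiset R) : ∃ M F, TMax.IsEdge
      (fun i => modulus (sv ((C a * (s.map fun y => X - C y).prod).coeff i)) * c ^ i) M F
      (F + s.countP fun y => modulus (sv y) = c) := by
  induction s using Multiset.induction_on with
  | empty =>
    have h0 : modulus (sv a) ≠ 0 := modulus_eq_zero.not.2 ((sv_eq_zero hsv).not.2 ha)
    have h1 : ∀ i, i ≠ 0 → modulus (sv ((C a : R[X]).coeff i)) * c ^ i = 0 := fun i hi => by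
      rw [coeff_C_of_ne_zero hi, hsv.map_zero, modulus_zero, zero_mul]
    have hpos : 0 < modulus (sv a) := lt_of_le_of_ne (TMax.zero_le _) h0.symm
    refine ⟨modulus (sv a), 0, ?_⟩
    simp only [Multiset.map_zero, Multiset.prod_zero, mul_one, Multiset.countP_zero]
    refine ⟨h0, by simp, by simp, ?_, by simp, fun i hi => by rw [h1 i (by omega)]; exact hpos⟩
    intro i
    rcases eq_or_ne i 0 with rfl | hi
    · simp
    · rw [h1 i hi]; exact hpos.le
  | cons y s ih =>
    obtain ⟨M, F, h⟩ := ih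
    have hw := isLinearProduct_sv hsv c y (C a * (s.map fun y => X - C y).prod)
    have e : C a * ((y ::ₘ s).map fun y => X - C y).prod =
        (X - C y) * (C a * (s.map fun y => X - C y).prod) := by
      rw [Multiset.map_cons, Multiset.prod_cons]; ring
    rw [e]
    -- Only a root of modulus exactly `c` lengthens the edge.
    rcases lt_trichotomy (modulus (sv y)) c with h1 | h1 | h1
    · rw [Multiset.countP_cons_of_neg (p := fun y => modulus (sv y) = c) _ h1.ne]
      have := h.mul_of_lt hw h1
      rw [add_right_comm] at this
      exact ⟨_, _, this⟩
    · rw [Multiset.countP_cons_of_pos (p := fun y => modulus (sv y) = c) _ h1]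
      rw [h1] at hw
      exact ⟨_, _, h.mul_of_eq hw hc⟩
    · rw [Multiset.countP_cons_of_neg (p := fun y => modulus (sv y) = c) _ h1.ne']
      exact ⟨_, _, h.mul_of_gt hw h1⟩

end SMax

namespace SMax

/-! ### Sign sequences at `⊖ r` and saturation polynomials -/

section saturation

variable {Γ : Type*} [AddCommGroup Γ] [LinearOrder Γ] [IsOrderedAddMonoid Γ]

theorem topSign_mul_opp_pow (M : TMax Γ) (r : SMax Γ) (i : ℕ) :
    ∀ a : SMax Γ, topSign M (a * r.opp ^ i) = (-1) ^ i * topSign M (a * r ^ i) := by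
  induction i with
  | zero => intro a; simp
  | succ i ih =>
    intro a
    rw [pow_succ', ← mul_assoc, mul_opp, ← opp_mul, topSign_opp, ih, pow_succ, pow_succ' r,
      mul_assoc a r]
    generalize (-1 : SignType) ^ i = s, topSign M (a * (r * r ^ i)) = t
    revert s t
    decide

/-- This lets the bounds at `r` and `⊖ r` be read from one and the same sequence. -/
theorem twist_signSeq (M : TMax Γ) (r : SMax Γ) (P : (SMax Γ)[X]) :
    twist (signSeq M r P) = signSeq M r.opp P :=
  funext fun i => (topSign_mul_opp_pow M r i _).symm

theorem isSigned_ofTMax (c : TMax Γ) : (ofTMax c).IsSigned := by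
  rcases TMax.eq_zero_or_of c with rfl | ⟨g, rfl⟩
  · exact isSigned_zero
  · exact Or.inl rfl

theorem ofTMax_ne_zero {c : TMax Γ} (hc : c ≠ 0) : ofTMax c ≠ 0 := by
  rwa [ne_eq, ← modulus_eq_zero, modulus_ofTMax]

theorem sgn_ofTMax {c : TMax Γ} (hc : c ≠ 0) : sgn (ofTMax c) = 1 := by
  rcases TMax.eq_zero_or_of c with rfl | ⟨g, rfl⟩
  · exact absurd rfl hc
  · rfl

theorem sgn_pow (a : SMax Γ) (n : ℕ) : sgn (a ^ n) = sgn a ^ n := by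
  induction n with
  | zero => rw [pow_zero, pow_zero]; rfl
  | succ n ih => rw [pow_succ, pow_succ, sgn_mul, ih]

/-- Since `|P(r)| = M`, the saturation set consists of the indices at the top level; the degree
condition is automatic because `M ≠ 0`. -/
theorem coeff_satPoly {M : TMax Γ} (hM : M ≠ 0) {r : SMax Γ} {P : (SMax Γ)[X]}
    (h : IsLevel M r P) (k : ℕ) : (satPoly r P).coeff k =
      if modulus (P.coeff k * r ^ k) = M then ofTMax M⁻¹ * r ^ k * P.coeff k else 0 := by
  rw [satPoly, finsetSum_coeff]
  simp only [coeff_monomial, Finset.sum_ite_eq', Finset.mem_filter, Finset.mem_range, sat,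
    Set.mem_ofPred_eq, h.modulus_eval hM, ← map_pow, ← map_mul]
  refine if_congr ⟨fun h1 => h1.2.2.symm, fun h1 => ?_⟩ rfl rfl
  have hk : k ≤ P.natDegree := by
    by_contra! hlt
    rw [coeff_eq_zero_of_natDegree_lt hlt, zero_mul, modulus_zero] at h1
    exact hM h1.symm
  exact ⟨by omega, hk, h1.symm⟩

theorem isNegative_iff_sgn {a : SMax Γ} (h : a ≠ 0) : a.IsNegative ↔ sgn a = -1 := by
  rcases a with _ | ⟨_ | _ | _, g⟩
  · exact absurd rfl h
  all_goals simp [IsNegative, sgn]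

/-- The coefficients of the saturation polynomial at a positive element are units, with the signs
of the monomials of largest modulus. -/
theorem satPoly_coeff_spec {M c : TMax Γ} (hM : M ≠ 0) (hc : c ≠ 0) {P : (SMax Γ)[X]}
    (hP : (system Γ).IsVeePoly P) (h : IsLevel M (ofTMax c) P) (k : ℕ) :
    ((satPoly (ofTMax c) P).coeff k ≠ 0 ↔ signSeq M (ofTMax c) P k ≠ 0) ∧
    (signSeq M (ofTMax c) P k ≠ 0 → ((satPoly (ofTMax c) P).coeff k).IsSigned ∧
      modulus ((satPoly (ofTMax c) P).coeff k) = 1 ∧ P.coeff k ≠ 0 ∧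
      sgn ((satPoly (ofTMax c) P).coeff k) = signSeq M (ofTMax c) P k ∧
      sgn (P.coeff k) = signSeq M (ofTMax c) P k) := by
  have hPk := mem_vee.1 (hP k)
  have hs : (P.coeff k * ofTMax c ^ k).IsSigned := hPk.mul ((isSigned_ofTMax c).pow k)
  have h1 : signSeq M (ofTMax c) P k ≠ 0 ↔ _ := topSign_ne_zero hM hs
  have hMi : M⁻¹ ≠ 0 := fun h0 => by
    have := TMax.inv_mul_cancel hM
    rw [h0, zero_mul] at this
    exact TMax.of_ne_zero _ this.symm
  have e := coeff_satPoly hM h k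
  rw [h1]
  by_cases h2 : modulus (P.coeff k * ofTMax c ^ k) = M
  · rw [if_pos h2] at e
    have hmod : modulus ((satPoly (ofTMax c) P).coeff k) = 1 := by
      rw [e, mul_assoc, map_mul, modulus_ofTMax, mul_comm (ofTMax c ^ k), h2,
        TMax.inv_mul_cancel hM]
    have hsgn : signSeq M (ofTMax c) P k = sgn (P.coeff k) := by
      rw [signSeq, topSign, if_pos h2, sgn_mul, sgn_pow, sgn_ofTMax hc, one_pow, mul_one]
    refine ⟨iff_of_true (fun h0 => ?_) h2, fun _ => ⟨?_, hmod, ?_, ?_, hsgn.symm⟩⟩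
    · rw [h0] at hmod
      exact TMax.of_ne_zero _ hmod.symm
    · rw [e]
      exact ((isSigned_ofTMax _).mul ((isSigned_ofTMax c).pow k)).mul hPk
    · intro h0
      rw [h0, zero_mul, modulus_zero] at h2
      exact hM h2.symm
    · rw [hsgn, e, sgn_mul, sgn_mul, sgn_pow, sgn_ofTMax hMi, sgn_ofTMax hc, one_pow, one_mul,
        one_mul]
  · rw [if_neg h2] at e
    exact ⟨iff_of_false (fun h0 => h0 e) h2, fun h0 => absurd h0 h2⟩

end saturation

/-! ### Multiplicities and gaps for split polynomials -/

section split

variable {R Γ : Type*} [Field R] [AddCommGroup Γ] [LinearOrder Γ] [IsOrderedAddMonoid Γ]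
  {sv : R → SMax Γ}

open Classical in
theorem multGE_countP (hsv : IsSignedValuation sv) (r : SMax Γ) (a : R) (s : Multiset R) :
    (system Γ).MultGE r (s.countP fun y => sv y = r)
      (coeffMap sv (C a * (s.map fun y => X - C y).prod)) := by
  refine multGE_coeffMap hsv r _ _
    (C a * ((s.filter fun y => ¬ sv y = r).map fun y => X - C y).prod)
    (s.filter fun y => sv y = r) (Multiset.countP_eq_card_filter _ _).symm
    (fun y hy => (Multiset.mem_filter.1 hy).2) ?_
  rw [mul_left_comm, ← Multiset.prod_add, ← Multiset.map_add, Multiset.filter_add_not]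

open Classical in
-- The signed elements of modulus `|r|` are `r` and `⊖ r`, and they are distinct as `r ≠ 0`.
theorem countP_modulus_eq (hsv : IsSignedValuation sv) {r : SMax Γ} (hr : r.IsSigned)
    (hr0 : r ≠ 0) (s : Multiset R) : (s.countP fun y => modulus (sv y) = modulus r) =
      (s.countP fun y => sv y = r) + s.countP fun y => sv y = r.opp := by
  have hne : r ≠ r.opp := fun h => by
    have h1 := congrArg sgn h
    rw [sgn_opp] at h1
    have h2 := sgn_ne_zero hr hr0
    revert h1 h2
    generalize sgn r = t
    revert t
    decide
  induction s using Multiset.induction_on with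
  | empty => rfl
  | cons y s ih =>
    simp only [Multiset.countP_cons, ih]
    by_cases h1 : sv y = r
    · simp only [h1, hne, if_true, if_false]; omega
    · by_cases h2 : sv y = r.opp
      · simp only [h2, modulus_opp, hne.symm, if_true, if_false]; omega
      · rw [if_neg h1, if_neg h2, if_neg fun h =>
          (eq_or_eq_opp_of_modulus_eq (sv_isSigned hsv y) hr h).elim h1 h2]
        omega

open Classical in
/-- For a split polynomial, Descartes' bounds for `r` and `⊖ r` are attained. -/
theorem descartes_sharp (hsv : IsSignedValuation sv) {r : SMax Γ} (hr : r.IsSigned) (hr0 : r ≠ 0)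
    {a : R} (ha : a ≠ 0) (s : Multiset R) {P : R[X]}
    (hP : P = C a * (s.map fun y => X - C y).prod) :
    ∃ M F E j, M ≠ 0 ∧ IsLevel M r (coeffMap sv P) ∧ signSeq M r (coeffMap sv P) F ≠ 0 ∧
      (∀ i < F, signSeq M r (coeffMap sv P) i = 0) ∧
      (∀ i, E < i → signSeq M r (coeffMap sv P) i = 0) ∧
      E ≤ signChanges (signSeq M r (coeffMap sv P)) j +
        signChanges (twist (signSeq M r (coeffMap sv P))) j + F ∧
      ∀ k, (system Γ).MultGE r k (coeffMap sv P) → k ≤ s.countP fun y => sv y = r := by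
  obtain ⟨M, F, hE⟩ := exists_isEdge hsv (modulus_eq_zero.not.2 hr0) ha s
  rw [← hP, countP_modulus_eq hsv hr hr0] at hE
  have hM := hE.ne_zero
  have hw : ∀ i, modulus (sv (P.coeff i)) * modulus r ^ i =
      modulus ((coeffMap sv P).coeff i * r ^ i) := fun i => by
    rw [coeff_coeffMap hsv.map_zero, map_mul, map_pow]
  have hw' : ∀ i, modulus (sv (P.coeff i)) * modulus r ^ i =
      modulus ((coeffMap sv P).coeff i * r.opp ^ i) := fun i => by
    rw [coeff_coeffMap hsv.map_zero, map_mul, map_pow, modulus_opp]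
  have hvee := isVeePoly_coeffMap hsv P
  have hL : IsLevel M r (coeffMap sv P) :=
    ⟨fun i => hw i ▸ hE.le i, F, by rw [← hw]; exact hE.eq_first⟩
  have hL' : IsLevel M r.opp (coeffMap sv P) :=
    ⟨fun i => hw' i ▸ hE.le i, F, by rw [← hw']; exact hE.eq_first⟩
  have h1 : signSeq M r (coeffMap sv P) F ≠ 0 :=
    (topSign_ne_zero hM ((mem_vee.1 (hvee F)).mul (hr.pow F))).2
      (by rw [← hw]; exact hE.eq_first)
  have h2 : ∀ i < F, signSeq M r (coeffMap sv P) i = 0 := fun i hi =>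
    topSign_of_lt (by rw [← hw]; exact hE.lt_of_lt i hi)
  have h3 : ∀ i, F + ((s.countP fun y => sv y = r) + s.countP fun y => sv y = r.opp) < i →
      signSeq M r (coeffMap sv P) i = 0 := fun i hi =>
    topSign_of_lt (by rw [← hw]; exact hE.lt_of_gt i hi)
  -- The roots above `r` and above `⊖ r` give two lower bounds on sign changes, whose sum is the
  -- length of the edge.
  obtain ⟨n₁, hn₁⟩ := exists_le_signChanges_of_multGE hr hr0 _ hM hvee hL
    (by rw [hP]; exact multGE_countP hsv r a s)
  obtain ⟨n₂, hn₂⟩ := exists_le_signChanges_of_multGE hr.opp (opp_ne_zero hr0) _ hM hvee hL'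
    (by rw [hP]; exact multGE_countP hsv r.opp a s)
  rw [← twist_signSeq] at hn₂
  refine ⟨M, F, _, max n₁ n₂, hM, hL, h1, h2, h3, ?_, fun k hk => ?_⟩
  · have := signChanges_mono (signSeq M r (coeffMap sv P)) (le_max_left n₁ n₂)
    have := signChanges_mono (twist (signSeq M r (coeffMap sv P))) (le_max_right n₁ n₂)
    omega
  -- A multiplicity `k` at `r` and the roots above `⊖ r` must fit together in the edge, which leaves
  -- room for `k` only up to the number of roots above `r`.
  · obtain ⟨n, hn⟩ := exists_le_signChanges_of_multGE hr hr0 k hM hvee hL hk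
    have := signChanges_mono (signSeq M r (coeffMap sv P)) (le_max_left n n₂)
    have := signChanges_mono (twist (signSeq M r (coeffMap sv P))) (le_max_right n n₂)
    have := signChanges_add_twist_le_sub h1 h2 h3 (max n n₂)
    omega

open Classical in
theorem le_countP_of_multGE (hsv : IsSignedValuation sv) {r : SMax Γ} (hr : r.IsSigned)
    {a : R} (ha : a ≠ 0) (s : Multiset R) {k : ℕ}
    (hk : (system Γ).MultGE r k (coeffMap sv (C a * (s.map fun y => X - C y).prod))) :
    k ≤ s.countP fun y => sv y = r := by
  rcases eq_or_ne r 0 with rfl | hr0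
  -- Zero has no sign, so this case is settled in the field: `Y^k` divides `P`, hence `0` occurs at
  -- least `k` times among its roots.
  · set P := C a * (s.map fun y => X - C y).prod with hP
    have hroots : P.roots = s := by
      rw [hP, roots_C_mul _ ha, roots_multiset_prod_X_sub_C]
    have hP0 : P ≠ 0 := mul_ne_zero (C_ne_zero.2 ha)
      (monic_multiset_prod_of_monic _ _ fun y _ => monic_X_sub_C y).ne_zero
    have h1 : (X - C 0) ^ k ∣ P := by
      rw [C_0, sub_zero, X_pow_dvd_iff]
      intro i hi
      have h2 := coeff_eq_zero_of_multGE_zero k (isVeePoly_coeffMap hsv P) hk i hi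
      rwa [coeff_coeffMap hsv.map_zero, sv_eq_zero hsv] at h2
    have h2 := (le_rootMultiplicity_iff hP0).2 h1
    rw [← count_roots, hroots] at h2
    refine h2.trans (le_of_eq (Multiset.countP_congr rfl fun y _ => ?_))
    exact propext (eq_comm.trans (sv_eq_zero hsv).symm)
  · obtain ⟨_, _, _, _, -, -, -, -, -, -, h⟩ := descartes_sharp hsv hr hr0 ha s rfl
    exact h k hk

open Classical in
theorem mult_coeffMap (hsv : IsSignedValuation sv) {r : SMax Γ} (hr : r.IsSigned)
    {a : R} (ha : a ≠ 0) (s : Multiset R) :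
    (system Γ).mult r (coeffMap sv (C a * (s.map fun y => X - C y).prod)) =
      (s.countP fun y => sv y = r : ℕ) := by
  refine le_antisymm (iSup₂_le fun k hk => ?_) ?_
  · exact_mod_cast le_countP_of_multGE hsv hr ha s hk
  · exact le_iSup₂_of_le (f := fun (k : ℕ) (_ : (system Γ).MultGE r k _) => (k : ℕ∞)) _
      (multGE_countP hsv r a s) le_rfl

theorem satPoly_gap (hsv : IsSignedValuation sv) {a : R} (ha : a ≠ 0) (s : Multiset R) {P : R[X]}
    (hP : P = C a * (s.map fun y => X - C y).prod) {c : TMax Γ} (hc : c ≠ 0) {k l : ℕ}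
    (hkl : k < l) (hk : (satPoly (ofTMax c) (coeffMap sv P)).coeff k ≠ 0)
    (hl : (satPoly (ofTMax c) (coeffMap sv P)).coeff l ≠ 0)
    (h0 : ∀ i, k < i → i < l → (satPoly (ofTMax c) (coeffMap sv P)).coeff i = 0) :
    (l = k + 1 ∨ (l = k + 2 ∧ (satPoly (ofTMax c) (coeffMap sv P)).coeff l =
      ((satPoly (ofTMax c) (coeffMap sv P)).coeff k).opp)) ∧
    ((satPoly (ofTMax c) (coeffMap sv P)).coeff l =
      ((satPoly (ofTMax c) (coeffMap sv P)).coeff k).opp ↔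
        ((coeffMap sv P).coeff l * (coeffMap sv P).coeff k).IsNegative) := by
  obtain ⟨M, F, E, j, hM, hL, h1, h2, h3, h4, -⟩ :=
    descartes_sharp hsv (isSigned_ofTMax c) (ofTMax_ne_zero hc) ha s hP
  have spec := satPoly_coeff_spec hM hc (isVeePoly_coeffMap hsv P) hL
  have hk' := (spec k).1.1 hk
  have hl' := (spec l).1.1 hl
  obtain ⟨sk, mk, pk, gk, gk'⟩ := (spec k).2 hk'
  obtain ⟨sl, ml, pl, gl, gl'⟩ := (spec l).2 hl'
  -- Nonzero coefficients of the saturation polynomial are signed of modulus `1`, so they are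
  -- determined by their signs.
  have key : (satPoly (ofTMax c) (coeffMap sv P)).coeff l =
      ((satPoly (ofTMax c) (coeffMap sv P)).coeff k).opp ↔
      signSeq M (ofTMax c) (coeffMap sv P) l = -signSeq M (ofTMax c) (coeffMap sv P) k := by
    rw [← gk, ← gl, ← sgn_opp]
    exact ⟨fun h => by rw [h], fun h => eq_of_modulus_eq_of_sgn_eq sl sk.opp
      (by rw [modulus_opp, mk, ml]) h⟩
  constructor
  · rw [key]
    exact gap_of_signChanges_eq h1 h2 h3 h4 hkl hk' hl' fun i hi hil =>
      not_not.1 fun h => (spec i).1.2 h (h0 i hi hil)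
  · have hne : (coeffMap sv P).coeff l * (coeffMap sv P).coeff k ≠ 0 := by
      rw [ne_eq, ← modulus_eq_zero, map_mul]
      exact TMax.mul_ne_zero (modulus_eq_zero.not.2 pl) (modulus_eq_zero.not.2 pk)
    rw [key, isNegative_iff_sgn hne, sgn_mul, gl', gk']
    revert hk' hl'
    generalize signSeq M (ofTMax c) (coeffMap sv P) k = u,
      signSeq M (ofTMax c) (coeffMap sv P) l = v
    revert u v
    decide

end split

end SMax

theorem mainTheorem10 {R Γ : Type*} [Field R] [LinearOrder R] [IsStrictOrderedRing R]
    [AddCommGroup Γ] [LinearOrder Γ] [IsOrderedAddMonoid Γ]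
    (hΓ : ∀ m : ℕ, 0 < m → ∀ g : Γ, ∃ h : Γ, m • h = g)
    (sv : R → SMax Γ) (hsv : (SemiringSystem.ofField R).IsMorphism (SMax.system Γ) sv)
    (n : ℕ) (P : R[X]) (hdeg : P.degree = n) (x : Fin n → R)
    (hx : P = C P.leadingCoeff * ∏ i, (X - C (x i))) :
    (∀ r : SMax Γ, r.IsSigned →
      ((SMax.system Γ).IsRoot r (coeffMap sv P) ↔ ∃ i, sv (x i) = r) ∧
      (SMax.system Γ).mult r (coeffMap sv P) = Nat.card {i : Fin n // sv (x i) = r}) ∧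
    (∀ c : TMax Γ, c ≠ 0 → TMax.IsCorner ((coeffMap sv P).map SMax.modulus) c →
      ∀ k l : ℕ, k < l →
        (SMax.satPoly (SMax.ofTMax c) (coeffMap sv P)).coeff k ≠ 0 →
        (SMax.satPoly (SMax.ofTMax c) (coeffMap sv P)).coeff l ≠ 0 →
        (∀ i, k < i → i < l → (SMax.satPoly (SMax.ofTMax c) (coeffMap sv P)).coeff i = 0) →
        (l = k + 1 ∨ (l = k + 2 ∧
          (SMax.satPoly (SMax.ofTMax c) (coeffMap sv P)).coeff l =
            ((SMax.satPoly (SMax.ofTMax c) (coeffMap sv P)).coeff k).opp)) ∧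
        ((SMax.satPoly (SMax.ofTMax c) (coeffMap sv P)).coeff l =
            ((SMax.satPoly (SMax.ofTMax c) (coeffMap sv P)).coeff k).opp ↔
          ((coeffMap sv P).coeff l * (coeffMap sv P).coeff k).IsNegative)) := by
  classical
  have ha : P.leadingCoeff ≠ 0 := leadingCoeff_ne_zero.2 fun h => by simp [h] at hdeg
  set s : Multiset R := Finset.univ.val.map x with hs
  have hP : P = C P.leadingCoeff * (s.map fun y => X - C y).prod := by
    rw [hs, Multiset.map_map]
    exact hx
  have hcount : ∀ r : SMax Γ,
      Nat.card {i : Fin n // sv (x i) = r} = s.countP fun y => sv y = r := fun r => by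
    rw [Nat.card_eq_fintype_card, Fintype.card_subtype, hs, Multiset.countP_map]
    rfl
  refine ⟨fun r hr => ⟨⟨fun h => ?_, ?_⟩, ?_⟩, fun c hc _ k l hkl hk hl h0 =>
    SMax.satPoly_gap hsv ha s hP hc hkl hk hl h0⟩
  -- Being a root is multiplicity at least one, so the upper bound yields some `x i` above `r`.
  · have h1 : (SMax.system Γ).MultGE r 1 (coeffMap sv P) := h
    rw [hP] at h1
    obtain ⟨y, hy, hyr⟩ := Multiset.countP_pos.1 (SMax.le_countP_of_multGE hsv hr ha s h1)
    obtain ⟨i, -, rfl⟩ := Multiset.mem_map.1 hy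
    exact ⟨i, hyr⟩
  · rintro ⟨i, rfl⟩
    refine SMax.isRoot_coeffMap hsv ?_
    rw [hx, eval_mul, eval_prod, Finset.prod_eq_zero (Finset.mem_univ i) (by simp), mul_zero]
  · rw [hcount, ← SMax.mult_coeffMap hsv hr ha s, ← hP]
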